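/- Let $P_0 \xleftarrow{f_0} P_1 \xleftarrow{f_1} P_2 \xleftarrow{f_2} \cdots$ be an inverse sequence of finite CW complexes and continuous maps such that $P_0=\{p_0\}$ is a single point and 1. every $P_i$ has exactly one $0$-cell $p_i$, and $f_i(p_{i+1})=p_i$; 2. no $P_i$ has a cell of positive dimension less than $i$. Let $C(f_0,f_1,f_2,\dots)$ be the infinite mapping cylinder, i.e. the quotient of $\bigsqcup_i P_i\sqcup\bigsqcup_i P_{i+1}\times[0,1]$ obtained by identifying, for all $i$ and $x\in P_{i+1}$, the point $(x,0)$ of the $i$-th cylinder with $f_i(x)\in P_i$ and $(x,1)$ with $x\in P_{i+1}$. Let $P^*$ be its one-point compactification, with the added point $*$ as base point. For $n\ge 1$ let $$\mathcal H^n=\Big\{x\in\mathbb R^{n+1} : (x_0-1/k)^2+\sum_{i=1}^n x_i^2=(1/k)^2 \text{ for some integer } k\ge 1\Big\},$$ with base point $\theta=0$, be the $n$-dimensional Hawaiian earrings, and let $\mathcal H_n(P^*,*)$ be the $n$-dimensional Hawaiian group of $(P^*,*)$: the set of base-point-preserving homotopy classes of maps $(\mathcal H^n,\theta)\to(P^*,*)$,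 with the class of the constant map as neutral element. Then for every $n\ge 1$ the group $\mathcal H_n(P^*,*)$ is trivial: every map $(\mathcal H^n,\theta)\to(P^*,*)$ is homotopic to the constant map relative to $\theta$. In particular this holds if, in addition, every $P_i$ is triangulable and the maps $\widetilde K^0_{\mathbb C}(f_i)$, $i\ge 1$, are isomorphisms of nontrivial groups. -/

import Mathlib

open Topology
open scoped unitInterval

/-- The disjoint union of the spaces `P i` and of the cylinders `P (i + 1) × [0, 1]`. -/
abbrev PreTelescope (P : ℕ → Type*) : Type _ :=
  (Σ i, P i) ⊕ (Σ i, P (i + 1) × I)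

/-- The identifications of the infinite mapping cylinder: for every `x : P (i + 1)`, the point
`(x, 0)` of the `i`-th cylinder is glued to `f i x` in `P i`, and the point `(x, 1)` is glued to
`x` in `P (i + 1)`. -/
inductive TelescopeRel {P : ℕ → Type*} [∀ i, TopologicalSpace (P i)]
    (f : ∀ i, C(P (i + 1), P i)) : PreTelescope P → PreTelescope P → Prop
  | bottom (i : ℕ) (x : P (i + 1)) :
      TelescopeRel f (Sum.inr ⟨i, (x, 0)⟩) (Sum.inl ⟨i, f i x⟩)
  | top (i : ℕ) (x : P (i + 1)) :
      TelescopeRel f (Sum.inr ⟨i, (x, 1)⟩) (Sum.inl ⟨i + 1, x⟩)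

/-- The infinite mapping cylinder `C(f 0, f 1, f 2, …)` of an inverse sequence
`P 0 ← P 1 ← P 2 ← ⋯`: the union of the mapping cylinders of the maps `f i`, consecutive ones
being glued along their common end, with the quotient topology. -/
def Telescope {P : ℕ → Type*} [∀ i, TopologicalSpace (P i)]
    (f : ∀ i, C(P (i + 1), P i)) : Type _ :=
  Quot (TelescopeRel f)

instance {P : ℕ → Type*} [∀ i, TopologicalSpace (P i)] (f : ∀ i, C(P (i + 1), P i)) :
    TopologicalSpace (Telescope f) :=
  inferInstanceAs (TopologicalSpace (Quot (TelescopeRel f)))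

/-- The `n`-dimensional Hawaiian earrings: the union over `k = 1, 2, 3, …` of the spheres in
`ℝ^(n+1)` of radius `1 / k` and centre `(1 / k, 0, …, 0)`. -/
def hawaiianEarrings (n : ℕ) : Set (EuclideanSpace ℝ (Fin (n + 1))) :=
  {x | ∃ k : ℕ, 1 ≤ k ∧
    (x 0 - 1 / (k : ℝ)) ^ 2 + ∑ i : Fin n, x i.succ ^ 2 = (1 / (k : ℝ)) ^ 2}

/-- The base point of the Hawaiian earrings is the origin. -/
def hawaiianBase (n : ℕ) : hawaiianEarrings n :=
  ⟨0, 1, le_rfl, by simp⟩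

/-- Continuous maps from the `n`-dimensional Hawaiian earrings to `X` which preserve the base
points. -/
def HawaiianMap (n : ℕ) (X : Type*) [TopologicalSpace X] (x₀ : X) : Type _ :=
  {g : C(hawaiianEarrings n, X) // g (hawaiianBase n) = x₀}

/-- Homotopy of such maps through maps that preserve the base points. -/
def hawaiianSetoid (n : ℕ) (X : Type*) [TopologicalSpace X] (x₀ : X) :
    Setoid (HawaiianMap n X x₀) where
  r g h := g.1.HomotopicRel h.1 {hawaiianBase n}
  iseqv :=
    ⟨fun g => ContinuousMap.HomotopicRel.refl g.1, fun h => h.symm, fun h h' => h.trans h'⟩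

/-- The (underlying set of the) `n`-dimensional Hawaiian group of `X` at `x₀`: base point
preserving homotopy classes of base point preserving maps from the `n`-dimensional Hawaiian
earrings to `X`. -/
def HawaiianGroup (n : ℕ) (X : Type*) [TopologicalSpace X] (x₀ : X) : Type _ :=
  Quotient (hawaiianSetoid n X x₀)

/-- The neutral element is the class of the constant map. -/
instance (n : ℕ) (X : Type*) [TopologicalSpace X] (x₀ : X) : One (HawaiianGroup n X x₀) :=
  ⟨Quotient.mk (hawaiianSetoid n X x₀) ⟨ContinuousMap.const _ x₀, rfl⟩⟩

/-!
Every base-point-preserving map `h` from the Hawaiian earrings `Y` to the one-point compactification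
`X` of the telescope is contracted to `∞` relative to the base point. Two facts drive the proof.

*The earrings have dimension `n`.* They are covered by the origin and the images of countably many
hyperplanes under the inversion `x ↦ x / ‖x‖ ^ 2`, so their Hausdorff dimension is at most `n`.
Hence a smooth approximation of a map from a closed subset `A` of `Y` to `ℝ ^ k`, `k > n`, has an
image of empty interior, and after a small translation it misses the origin, which is
`AvoidsOrigin A k`. Consequently a map from `A` to a CW complex can be pushed off the centre of a
`k`-cell, and then radially to the boundary of the cell, without moving the points outside the open
cell (`homotopicRel_push_off_cell`). Since `P i` has a single vertex `p i` and, for `i > n`, all its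
other cells have dimension greater than `n`, every map from `A` to `P i` contracts to `p i` relative
to the preimage of `p i` (`homotopicRel_const_of_cells`).

*Neighbourhoods of `∞` are detected by the height.* The telescope carries a height function, equal
to `i` on `P i` and to `i + t` on the slice `P (i + 1) × {t}` of the `i`-th cylinder. A map to `X`
is continuous at a point over `∞` as soon as its height tends to `∞`; so infinitely many homotopies,
supported over disjoint strips of heights and respecting these strips, can be glued
(`exists_glue_homotopy`). Pushing points down along the cylinders by a bounded amount is a homotopy
of `X` as well (`homotopicRel_extFlow`).

Call *ray* the image of the points `p i` and of the cylinders over them, together with `∞`. With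
`m = n + 1`, the map `h` is deformed in four steps.

* Over the middle third of the `i`-th cylinder, `i ≥ m`, the coordinate in `P (i + 1)` is contracted
  to `p (i + 1)`, the contraction being damped towards the ends of the cylinder
  (`exists_onRay_middle`).
* The remaining part around `P (i + 1)`, at heights between `i + 2 / 3` and `i + 4 / 3`, is pushed
  down to height `i`, and contracted there to `p i`. This is possible relative to the ends of the
  strip, which already lie on the ray. Now all points of height greater than `m + 1` are on the ray
  (`exists_onRay_or_extHeight_le`).
* Pushing down by `m + 1` brings the other points to `P 0`, which is a point of the ray.
* The ray is an arc ending at `∞`, and it is contracted to `∞` (`homotopicRel_infty_of_onRay`).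
-/

open Set Metric Filter

/-! ### The dimension of the Hawaiian earrings -/

/-- Every continuous map from `A` to `ℝ ^ k` can be approximated uniformly by continuous maps which
miss the origin. This is how `A` having dimension less than `k` is used. -/
def AvoidsOrigin (A : Type*) [TopologicalSpace A] (k : ℕ) : Prop :=
  ∀ φ : C(A, Fin k → ℝ), ∀ ε > 0, ∃ ψ : C(A, Fin k → ℝ),
    (∀ a, ‖ψ a - φ a‖ < ε) ∧ ∀ a, ψ a ≠ 0

/-- The map is extended to the ambient space and approximated by a smooth map, under which the image
of `A` has Hausdorff dimension less than `k`; a small translation then moves it off the origin. -/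
theorem avoidsOrigin_of_dimH_lt {A E : Type*} [TopologicalSpace A] [NormedAddCommGroup E]
    [NormedSpace ℝ E] [FiniteDimensional ℝ E] {e : A → E} (he : IsClosedEmbedding e) {k : ℕ}
    (hdim : dimH (range e) < k) : AvoidsOrigin A k := by
  intro φ ε hε
  obtain ⟨g, hg⟩ := ContinuousMap.exists_extension he φ
  obtain ⟨h, hh, hgh, -⟩ := g.continuous.exists_contDiff_approx 1 (ε := fun _ ↦ ε / 2)
    continuous_const (fun _ ↦ half_pos hε)
  have hd : Dense (h '' range e)ᶜ := by
    apply dense_compl_of_dimH_lt_finrank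
    refine lt_of_le_of_lt (hh.contDiffOn.dimH_image_le convex_univ (subset_univ _)) ?_
    simpa using hdim
  obtain ⟨c, hc, hc'⟩ := hd.exists_mem_open isOpen_ball
    ⟨(0 : Fin k → ℝ), mem_ball_self (half_pos hε)⟩
  have hcont : Continuous fun a ↦ h (e a) - c :=
    (hh.continuous.comp he.continuous).sub continuous_const
  refine ⟨⟨_, hcont⟩, fun a ↦ ?_, fun a ha ↦ ?_⟩
  · have h1 : dist (h (e a)) (g (e a)) < ε / 2 := hgh _
    have h2 : g (e a) = φ a := by rw [← hg]; rfl
    rw [h2, dist_eq_norm] at h1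
    have h3 : ‖c‖ < ε / 2 := by simpa using hc'
    calc ‖h (e a) - c - φ a‖ = ‖(h (e a) - φ a) - c‖ := by congr 1; abel
      _ ≤ ‖h (e a) - φ a‖ + ‖c‖ := norm_sub_le _ _
      _ < ε := by linarith
  · exact hc ⟨e a, ⟨a, rfl⟩, sub_eq_zero.1 ha⟩

/-- Form of the equations of the spheres which exhibits them as the inverses of the hyperplanes
`x 0 = k / 2`. -/
theorem mem_hawaiianEarrings_iff {n : ℕ} {x : EuclideanSpace ℝ (Fin (n + 1))} :
    x ∈ hawaiianEarrings n ↔ ∃ k : ℕ, 1 ≤ k ∧ k * ‖x‖ ^ 2 = 2 * x 0 := by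
  refine exists_congr fun k ↦ and_congr_right fun hk ↦ ?_
  have hk' : (k : ℝ) ≠ 0 := by positivity
  rw [EuclideanSpace.real_norm_sq_eq, Fin.sum_univ_succ]
  generalize ∑ i : Fin n, x i.succ ^ 2 = S
  constructor
  · intro h
    field_simp at h
    exact mul_left_cancel₀ hk' (by linear_combination h)
  · intro h
    field_simp
    linear_combination (k : ℝ) * h

theorem isClosed_hawaiianEarrings (n : ℕ) : IsClosed (hawaiianEarrings n) := by
  have hK : IsClosed (((↑) : ℕ → ℝ) '' {k | 1 ≤ k}) :=
    (Nat.isClosedEmbedding_coe_real).isClosedMap _ (isClosed_discrete _)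
  have hopen : IsOpen ({0}ᶜ ∩ (fun x : EuclideanSpace ℝ (Fin (n + 1)) ↦ 2 * x 0 / ‖x‖ ^ 2) ⁻¹'
      (((↑) : ℕ → ℝ) '' {k | 1 ≤ k})ᶜ) := by
    refine ContinuousOn.isOpen_inter_preimage (fun x hx ↦ ContinuousAt.continuousWithinAt ?_)
      isOpen_compl_singleton hK.isOpen_compl
    have : ‖x‖ ^ 2 ≠ 0 := by simpa using hx
    fun_prop (disch := assumption)
  rw [← isOpen_compl_iff]
  convert hopen using 1
  ext x
  simp only [mem_compl_iff, mem_inter_iff, mem_preimage, mem_image, mem_singleton_iff,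
    mem_ofPred_eq, mem_hawaiianEarrings_iff, ← not_or, not_iff_not]
  by_cases hx : x = 0
  · simp only [hx, true_or, iff_true]; exact ⟨1, le_rfl, by simp⟩
  · have : ‖x‖ ^ 2 ≠ 0 := by simpa using hx
    simp [hx, eq_div_iff this]

theorem isCompact_hawaiianEarrings (n : ℕ) : IsCompact (hawaiianEarrings n) := by
  refine Metric.isCompact_of_isClosed_isBounded (isClosed_hawaiianEarrings n) ?_
  refine (isBounded_closedBall (x := 0) (r := 2)).subset fun x hx ↦ ?_
  obtain ⟨k, hk, h⟩ := mem_hawaiianEarrings_iff.1 hx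
  have h1 : (1 : ℝ) ≤ k := by exact_mod_cast hk
  have h2 : x 0 ≤ ‖x‖ := (le_abs_self _).trans (PiLp.norm_apply_le x 0)
  rw [mem_closedBall_zero_iff]
  by_contra! h3
  nlinarith [sq_nonneg ‖x‖, norm_nonneg x]

theorem dimH_hawaiianEarrings_le (n : ℕ) : dimH (hawaiianEarrings n) ≤ n := by
  -- `w k` parametrizes the hyperplane `x 0 = k / 2`, whose inverse is the `k`-th sphere
  let w : ℕ → EuclideanSpace ℝ (Fin n) → EuclideanSpace ℝ (Fin (n + 1)) := fun k y ↦
    WithLp.toLp 2 (Fin.cons ((k : ℝ) / 2) y)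
  have hw : ∀ k, ContDiff ℝ 1 (w k) := by
    intro k
    rw [contDiff_piLp]
    intro i
    refine Fin.cases ?_ (fun j ↦ ?_) i
    · simpa [w] using contDiff_const
    · simp only [w, Fin.cons_succ]; fun_prop
  have hw0 : ∀ k, 1 ≤ k → ∀ y, ‖w k y‖ ^ 2 ≠ 0 := by
    intro k hk y h
    have : w k y 0 = 0 := by
      have : w k y = 0 := by simpa using h
      rw [this]; rfl
    simp [w] at this
    omega
  have hsub : hawaiianEarrings n ⊆
      {0} ∪ ⋃ k : ℕ, ⋃ _ : 1 ≤ k, range fun y ↦ (‖w k y‖ ^ 2)⁻¹ • w k y := by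
    intro x hx
    obtain ⟨k, hk, h⟩ := mem_hawaiianEarrings_iff.1 hx
    by_cases hx0 : x = 0
    · exact Or.inl hx0
    · right
      have hx' : ‖x‖ ^ 2 ≠ 0 := by simpa using hx0
      simp only [mem_iUnion]
      refine ⟨k, hk, WithLp.toLp 2 (fun i ↦ (‖x‖ ^ 2)⁻¹ * x i.succ), ?_⟩
      have : w k (WithLp.toLp 2 (fun i ↦ (‖x‖ ^ 2)⁻¹ * x i.succ)) = (‖x‖ ^ 2)⁻¹ • x := by
        ext i
        refine Fin.cases ?_ (fun j ↦ ?_) i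
        · simp only [w, Fin.cons_zero, PiLp.smul_apply, smul_eq_mul]
          field_simp
          linarith
        · simp [w]
      simp only [this, norm_smul, smul_smul]
      rw [norm_inv, norm_pow, norm_norm]
      convert one_smul ℝ x using 2
      have : ‖x‖ ≠ 0 := by simpa using hx0
      field_simp
  refine (dimH_mono hsub).trans ?_
  rw [dimH_union, dimH_singleton, dimH_iUnion]
  simp only [zero_le, sup_of_le_right, iSup_le_iff]
  intro k
  rw [dimH_iUnion, iSup_le_iff]
  intro hk
  refine (ContDiff.dimH_range_le ?_).trans (by simp)
  exact (((hw k).norm_sq ℝ).inv (hw0 k hk)).smul (hw k)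

instance (n : ℕ) : CompactSpace (hawaiianEarrings n) :=
  isCompact_iff_compactSpace.1 (isCompact_hawaiianEarrings n)

theorem avoidsOrigin_hawaiianEarrings {n k : ℕ} (hk : n < k) (A : Set (hawaiianEarrings n))
    (hA : IsClosed A) : AvoidsOrigin A k := by
  refine avoidsOrigin_of_dimH_lt (e := fun a : A ↦ (a : EuclideanSpace ℝ (Fin (n + 1))))
    ((isClosed_hawaiianEarrings n).isClosedEmbedding_subtypeVal.comp
      hA.isClosedEmbedding_subtypeVal) ?_
  refine lt_of_le_of_lt ((dimH_mono ?_).trans (dimH_hawaiianEarrings_le n)) (by exact_mod_cast hk)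
  rintro _ ⟨a, rfl⟩
  exact a.1.2

/-! ### Pushing maps off the cells of a CW complex -/

/-- A map on a Hausdorff space `A` can be defined piecewise: on the image of a compact space `E` by
a map `g` on `E` which is constant on the fibres of `e`, and on a closed set `B` by a map `h`. -/
theorem exists_continuousMap_glue {E A Z : Type*} [TopologicalSpace E] [TopologicalSpace A]
    [TopologicalSpace Z] [CompactSpace E] [T2Space A] (e : C(E, A)) {B : Set A} (hB : IsClosed B)
    (hcov : ∀ a, a ∈ range e ∨ a ∈ B) (g : C(E, Z)) (h : C(A, Z))
    (hg : ∀ x y, e x = e y → g x = g y) (hgh : ∀ x, e x ∈ B → g x = h (e x)) :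
    ∃ G : C(A, Z), (∀ x, G (e x) = g x) ∧ ∀ a ∈ B, G a = h a := by
  classical
  let G : A → Z := fun a ↦ if ha : a ∈ range e then g ha.choose else h a
  have hGe : ∀ x, G (e x) = g x := fun x ↦ by
    have hx : e x ∈ range e := ⟨x, rfl⟩
    simp only [G, dif_pos hx]
    exact hg _ _ hx.choose_spec
  have hGB : ∀ a ∈ B, G a = h a := fun a ha ↦ by
    by_cases hx : a ∈ range e
    · obtain ⟨x, rfl⟩ := hx
      rw [hGe, hgh x ha]
    · simp only [G, dif_neg hx]
  refine ⟨⟨G, continuous_iff_isClosed.2 fun F hF ↦ ?_⟩, hGe, hGB⟩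
  have : G ⁻¹' F = e '' (g ⁻¹' F) ∪ (B ∩ h ⁻¹' F) := by
    ext a
    constructor
    · intro ha
      rcases hcov a with ⟨x, rfl⟩ | hb
      · exact Or.inl ⟨x, by rwa [mem_preimage, ← hGe], rfl⟩
      · exact Or.inr ⟨hb, by rwa [mem_preimage, ← hGB a hb]⟩
    · rintro (⟨x, hx, rfl⟩ | ⟨hb, ha⟩)
      · rwa [mem_preimage, hGe]
      · rwa [mem_preimage, hGB a hb]
  rw [this]
  exact (e.continuous.isClosedMap _ (hF.preimage g.continuous)).union
    (hB.inter (hF.preimage h.continuous))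

/-- If `X` contains the closed set `W` and a closed `k`-cell attached to it by the characteristic
map `c`, a map `u` from a space of dimension less than `k` to the union of `W` and the cell is
homotopic, relative to any set `S` of points which it maps to `W`, to a map to `W`. Near the centre
of the cell, `u` is replaced by a map which misses the centre, and the result is pushed radially to
the boundary. -/
theorem homotopicRel_push_off_cell {X : Type*} [TopologicalSpace X] [T2Space X] {k : ℕ}
    {c : (Fin k → ℝ) → X} (hc : ContinuousOn c (closedBall 0 1)) {W : Set X} (hW : IsClosed W)
    (hinj : InjOn c (ball 0 1)) (hball : ∀ v ∈ ball 0 1, c v ∉ W)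
    (hsphere : ∀ v ∈ sphere 0 1, c v ∈ W)
    {A : Type*} [TopologicalSpace A] [CompactSpace A] [T2Space A] (hA : AvoidsOrigin A k)
    (u : C(A, X)) (hu : ∀ a, u a ∈ W ∪ c '' closedBall 0 1) {S : Set A} (hS : ∀ a ∈ S, u a ∈ W) :
    ∃ v : C(A, X), (∀ a, v a ∈ W) ∧ u.HomotopicRel v S := by
  let D := closedBall (0 : Fin k → ℝ) 1
  have : CompactSpace D := isCompact_iff_compactSpace.1 (isCompact_closedBall _ _)
  let cD : C(D, X) := ⟨fun d ↦ c d, hc.comp_continuous continuous_subtype_val fun d ↦ d.2⟩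
  have hD : ∀ d : D, ‖(d : Fin k → ℝ)‖ ≤ 1 := fun d ↦ mem_closedBall_zero_iff.1 d.2
  have hnorm : ∀ d : D, cD d ∈ W → ‖(d : Fin k → ℝ)‖ = 1 := by
    intro d hd
    by_contra hne
    exact hball d (by simpa using lt_of_le_of_ne (hD d) hne) hd
  have hmemW : ∀ d : D, ‖(d : Fin k → ℝ)‖ = 1 → cD d ∈ W := fun d hd ↦
    hsphere d (by simpa using hd)
  have hfib : ∀ d d' : D, cD d = cD d' → d = d' ∨
      ‖(d : Fin k → ℝ)‖ = 1 ∧ ‖(d' : Fin k → ℝ)‖ = 1 := by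
    intro d d' h
    by_cases h1 : ‖(d : Fin k → ℝ)‖ = 1
    · exact Or.inr ⟨h1, hnorm _ (h ▸ hmemW d h1)⟩
    · by_cases h2 : ‖(d' : Fin k → ℝ)‖ = 1
      · exact absurd (hnorm _ (h.symm ▸ hmemW d' h2)) h1
      · exact Or.inl (Subtype.ext (hinj (by simpa using lt_of_le_of_ne (hD d) h1)
          (by simpa using lt_of_le_of_ne (hD d') h2) h))
  -- `E` consists of the points which `u` maps to the closed cell, with a choice of coordinates in
  -- the ball; the coordinates are unique, except on the boundary sphere
  let E := {q : A × D | u q.1 = cD q.2}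
  have hE : IsClosed E := isClosed_eq (by fun_prop) (by fun_prop)
  have : CompactSpace E := isCompact_iff_compactSpace.1 hE.isCompact
  let e : C(E, A) := ⟨fun q ↦ q.1.1, by fun_prop⟩
  let vec : C(E, Fin k → ℝ) := ⟨fun q ↦ q.1.2.1, by fun_prop⟩
  have hvec : ∀ q, ‖vec q‖ ≤ 1 := fun q ↦ hD _
  have heE : ∀ q : E, u (e q) = cD q.1.2 := fun q ↦ q.2
  have hfibE : ∀ q q', e q = e q' → vec q = vec q' ∨ ‖vec q‖ = 1 ∧ ‖vec q'‖ = 1 := by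
    intro q q' h
    rcases hfib q.1.2 q'.1.2 (by rw [← heE, ← heE, h]) with h | h
    · exact Or.inl (congrArg Subtype.val h)
    · exact Or.inr h
  have hBE : ∀ q, u (e q) ∈ W → ‖vec q‖ = 1 := fun q h ↦ hnorm q.1.2 (heE q ▸ h)
  have hB : IsClosed (u ⁻¹' W) := hW.preimage u.continuous
  have hcov : ∀ a, a ∈ range e ∨ a ∈ u ⁻¹' W := by
    intro a
    rcases hu a with h | ⟨d, hd, hda⟩
    · exact Or.inr h
    · exact Or.inl ⟨⟨(a, ⟨d, hd⟩), hda.symm⟩, rfl⟩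
  -- the coordinates, cut off near the sphere so as to extend continuously by zero
  obtain ⟨φ, hφE, -⟩ := exists_continuousMap_glue e hB hcov
    ⟨fun q ↦ min 1 (2 * (1 - ‖vec q‖)) • vec q, by fun_prop⟩ (0 : C(A, Fin k → ℝ))
    (fun q q' h ↦ by
      rcases hfibE q q' h with h | ⟨h, h'⟩
      · simp [h]
      · simp [h, h'])
    (fun q h ↦ by simp [hBE q h])
  obtain ⟨ψ, hψ, hψ0⟩ := hA φ (1 / 8) (by norm_num)
  -- `w` equals `ψ` where the norm of the coordinates is at most `1 / 4`, and equals the coordinates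
  -- where it is at least `1 / 2`; in between, the error `1 / 8` is too small to create a zero
  let w : C(E, Fin k → ℝ) :=
    ⟨fun q ↦ vec q + max 0 (min 1 (2 - 4 * ‖vec q‖)) • (ψ (e q) - φ (e q)), by fun_prop⟩
  have hw_eq : ∀ q, ‖vec q‖ = 1 → w q = vec q := by
    intro q hq
    simp only [w, ContinuousMap.coe_mk, hq]
    norm_num
  have hw0 : ∀ q, w q ≠ 0 := by
    intro q
    rcases le_total ‖vec q‖ (1 / 4) with hq | hq
    · have h1 : φ (e q) = vec q := by
        rw [hφE, ContinuousMap.coe_mk, min_eq_left (by linarith), one_smul]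
      have h2 : w q = ψ (e q) := by
        simp only [w, ContinuousMap.coe_mk]
        rw [h1, min_eq_left (by linarith), max_eq_right zero_le_one, one_smul]
        abel
      rw [h2]
      exact hψ0 _
    · intro h0
      have h1 : vec q = -(max 0 (min 1 (2 - 4 * ‖vec q‖)) • (ψ (e q) - φ (e q))) :=
        eq_neg_of_add_eq_zero_left h0
      have h2 : ‖vec q‖ ≤ 1 * (1 / 8) := by
        rw [h1, norm_neg, norm_smul, Real.norm_of_nonneg (le_max_left _ _)]
        exact mul_le_mul (max_le zero_le_one (min_le_left _ _)) (hψ _).le (norm_nonneg _)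
          zero_le_one
      linarith
  -- the straight line homotopy from the coordinates to the radial projection of `w` on the sphere
  let L : C(E × I, D) := ⟨fun q ↦ ⟨(1 - (q.2 : ℝ)) • vec q.1 + (q.2 : ℝ) • (‖w q.1‖⁻¹ • w q.1), by
      rw [mem_closedBall_zero_iff]
      have h0 := q.2.2.1
      have h1 := q.2.2.2
      have h2 : ‖‖w q.1‖⁻¹ • w q.1‖ = 1 := norm_smul_inv_norm (𝕜 := ℝ) (hw0 q.1)
      refine (norm_add_le _ _).trans ?_
      rw [norm_smul, norm_smul _ (‖w q.1‖⁻¹ • w q.1), h2, Real.norm_of_nonneg h0,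
        Real.norm_of_nonneg (sub_nonneg.2 h1)]
      nlinarith [hvec q.1]⟩, by
    have : ∀ q : E × I, ‖w q.1‖ ≠ 0 := fun q ↦ norm_ne_zero_iff.2 (hw0 q.1)
    fun_prop (disch := assumption)⟩
  have hL : ∀ q s, ‖vec q‖ = 1 → L (q, s) = q.1.2 := by
    intro q s hq
    refine Subtype.ext ?_
    simp only [L, ContinuousMap.coe_mk, hw_eq q hq, hq]
    rw [inv_one, one_smul, ← add_smul, sub_add_cancel, one_smul]
    rfl
  obtain ⟨H, hHE, hHB⟩ := exists_continuousMap_glue (e.prodMap (ContinuousMap.id I))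
    (B := Prod.fst ⁻¹' (u ⁻¹' W)) (hB.preimage continuous_fst)
    (fun a ↦ (hcov a.1).imp (fun ⟨q, hq⟩ ↦ ⟨(q, a.2), Prod.ext hq rfl⟩) id)
    (cD.comp L) (u.comp ContinuousMap.fst)
    (by
      rintro ⟨q, s⟩ ⟨q', s'⟩ h
      obtain ⟨h1, rfl : s = s'⟩ := Prod.ext_iff.1 h
      replace h1 : e q = e q' := h1
      rcases hfibE q q' h1 with h2 | ⟨h2, h3⟩
      · have : q = q' := Subtype.ext (Prod.ext h1 (Subtype.ext h2))
        rw [this]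
      · simp only [ContinuousMap.comp_apply, hL _ _ h2, hL _ _ h3, ← heE, h1])
    (by
      rintro ⟨q, s⟩ h
      simp only [ContinuousMap.comp_apply, hL _ _ (hBE q h), ← heE]
      rfl)
  refine ⟨⟨fun a ↦ H (a, 1), by fun_prop⟩, fun a ↦ ?_, ⟨⟨⟨⟨fun x ↦ H (x.2, x.1), by fun_prop⟩,
    fun a ↦ ?_, fun a ↦ rfl⟩, fun s a ha ↦ ?_⟩⟩⟩
  · rcases hcov a with ⟨q, rfl⟩ | h
    · have h1 : H (e q, 1) = cD (L (q, 1)) := hHE (q, 1)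
      simp only [ContinuousMap.coe_mk, h1]
      apply hmemW
      simp only [L, ContinuousMap.coe_mk, Set.Icc.coe_one, sub_self, zero_smul, zero_add,
        one_smul]
      exact norm_smul_inv_norm (𝕜 := ℝ) (hw0 q)
    · have h1 : H (a, 1) = u a := hHB (a, 1) h
      simp only [ContinuousMap.coe_mk, h1]
      exact h
  · rcases hcov a with ⟨q, rfl⟩ | h
    · have h1 : H (e q, 0) = cD (L (q, 0)) := hHE (q, 0)
      change H (e q, 0) = _
      rw [h1, heE]
      congr 1
      refine Subtype.ext ?_
      simp [L]
      rfl
    · exact hHB (a, 0) h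
  · exact hHB (a, s) (hS a ha)

open RelCWComplex in
/-- A map `u` to a finite CW complex with a single vertex `p` contracts to `p` relative to any set
of points which it maps to `p`, if its source has dimension less than that of every other cell. The
cells are removed one at a time, in order of decreasing dimension. -/
theorem homotopicRel_const_of_cells {X : Type*} [TopologicalSpace X] [T2Space X]
    [CWComplex (univ : Set X)] [CWComplex.Finite (univ : Set X)] {p : X}
    (hvertex : ∃ e : cell (univ : Set X) 0, (∀ e', e' = e) ∧ closedCell 0 e = {p})
    {A : Type*} [TopologicalSpace A] [CompactSpace A] [T2Space A]
    (hA : ∀ k, 0 < k → Nonempty (cell (univ : Set X) k) → AvoidsOrigin A k)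
    (u : C(A, X)) {S : Set A} (hS : ∀ a ∈ S, u a = p) :
    u.HomotopicRel (ContinuousMap.const A p) S := by
  obtain ⟨e₀, he₀, hp⟩ := hvertex
  have hpmem : ∀ d : ℕ, p ∈ skeletonLT (univ : Set X) ((d + 1 : ℕ) : ℕ∞) := by
    intro d
    refine skeletonLT_mono (m := ((0 : ℕ) : ℕ∞) + 1) (by norm_cast; omega)
      (closedCell_subset_skeletonLT 0 e₀ ?_)
    rw [hp]; rfl
  have key : ∀ (d : ℕ) (u : C(A, X)), (∀ a ∈ S, u a = p) →
      (∀ a, u a ∈ skeletonLT (univ : Set X) ((d + 1 : ℕ) : ℕ∞)) →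
      u.HomotopicRel (ContinuousMap.const A p) S := by
    intro d
    induction d with
    | zero =>
      intro u _ hu
      convert ContinuousMap.HomotopicRel.refl u using 1
      ext a
      obtain ⟨m, hm, e, he⟩ := CWComplex.mem_skeletonLT_iff.1 (hu a)
      obtain rfl : m = 0 := by
        have : m < 0 + 1 := by exact_mod_cast hm
        omega
      have h1 := openCell_subset_closedCell _ _ he
      rw [he₀ e, hp] at h1
      exact h1.symm
    | succ d ih =>
      have : Finite (cell (univ : Set X) (d + 1)) := FiniteType.finite_cell (d + 1)
      have := Fintype.ofFinite (cell (univ : Set X) (d + 1))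
      let Z : Finset (cell (univ : Set X) (d + 1)) → Set X := fun F ↦
        skeletonLT (univ : Set X) ((d + 1 : ℕ) : ℕ∞) ∪ ⋃ e ∈ F, closedCell (d + 1) e
      have hZ : ∀ F, IsClosed (Z F) := fun F ↦ (Subcomplex.closed _).union
        (F.finite_toSet.isClosed_biUnion fun e _ ↦ isClosed_closedCell)
      have key : ∀ (F : Finset (cell (univ : Set X) (d + 1))) (u : C(A, X)),
          (∀ a ∈ S, u a = p) → (∀ a, u a ∈ Z F) →
          u.HomotopicRel (ContinuousMap.const A p) S := by
        classical
        intro F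
        induction F using Finset.induction_on with
        | empty =>
          intro u hS hu
          exact ih u hS fun a ↦ by simpa [Z] using hu a
        | insert e F heF ihF =>
          intro u hS hu
          have hfr : cellFrontier (d + 1) e ⊆ skeletonLT (univ : Set X) ((d + 1 : ℕ) : ℕ∞) :=
            cellFrontier_subset_skeletonLT (d + 1) e
          have hdisj : Disjoint (openCell (d + 1) e) (Z F) := by
            rw [Set.disjoint_union_right, Set.disjoint_iUnion₂_right]
            have h1 : Disjoint (openCell (d + 1) e)
                (skeletonLT (univ : Set X) ((d + 1 : ℕ) : ℕ∞)) :=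
              (disjoint_skeletonLT_openCell (by norm_cast)).symm
            refine ⟨h1, fun e' he' ↦ ?_⟩
            rw [← cellFrontier_union_openCell_eq_closedCell, Set.disjoint_union_right]
            refine ⟨h1.mono_right (cellFrontier_subset_skeletonLT (d + 1) e'),
              disjoint_openCell_of_ne fun h ↦ heF ?_⟩
            obtain rfl : e = e' := by simpa using h
            exact he'
          obtain ⟨v, hv, huv⟩ := homotopicRel_push_off_cell (continuousOn (d + 1) e) (hZ F)
            (source_eq (d + 1) e ▸ (map (d + 1) e).injOn)
            (fun x hx h ↦ Set.disjoint_left.1 hdisj ⟨x, hx, rfl⟩ h)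
            (fun x hx ↦ Or.inl (hfr ⟨x, hx, rfl⟩)) (hA (d + 1) (by omega) ⟨e⟩) u
            (fun a ↦ by
              rcases hu a with h | h
              · exact Or.inl (Or.inl h)
              · rw [Finset.set_biUnion_insert] at h
                rcases h with h | h
                · exact Or.inr h
                · exact Or.inl (Or.inr h))
            (S := S) (fun a ha ↦ by rw [hS a ha]; exact Or.inl (hpmem d))
          refine huv.trans (ihF v (fun a ha ↦ ?_) hv)
          rw [← hS a ha]
          exact (huv.fst_eq_snd ha).symm
      intro u hS hu
      refine key Finset.univ u hS fun a ↦ ?_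
      have h1 := hu a
      rw [← SetLike.mem_coe, Nat.cast_succ,
        ← CWComplex.skeletonLT_union_iUnion_closedCell_eq_skeletonLT_succ] at h1
      simpa [Z] using h1
  obtain ⟨d, hd⟩ : ∃ d : ℕ, ∀ m ≥ d, IsEmpty (cell (univ : Set X) m) :=
    Filter.eventually_atTop.1 FiniteDimensional.eventually_isEmpty_cell
  refine key d u hS fun a ↦ ?_
  have h1 : u a ∈ ⋃ (n : ℕ) (j : cell (univ : Set X) n), openCell n j := by
    rw [CWComplex.iUnion_openCell_eq_complex]; trivial
  simp only [mem_iUnion] at h1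
  obtain ⟨m, e, he⟩ := h1
  refine CWComplex.mem_skeletonLT_iff.2 ⟨m, ?_, e, he⟩
  have : m < d := by
    by_contra! h
    exact (hd m h).false e
  exact_mod_cast this.trans d.lt_succ_self

open RelCWComplex in
theorem compactSpace_of_finite_CWComplex (X : Type*) [TopologicalSpace X]
    [CWComplex (univ : Set X)] [CWComplex.Finite (univ : Set X)] : CompactSpace X := by
  have := RelCWComplex.finite_cells_of_finite (C := (univ : Set X))
  have h : (univ : Set X) = ⋃ e : Σ n, cell (univ : Set X) n, closedCell e.1 e.2 := by
    rw [iUnion_sigma]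
    exact CWComplex.union.symm
  exact ⟨h ▸ isCompact_iUnion fun e ↦ isCompact_closedCell⟩

/-! ### Height in the infinite mapping cylinder -/

namespace Telescope

variable {P : ℕ → Type*} [∀ i, TopologicalSpace (P i)] (f : ∀ i, C(P (i + 1), P i))

/-- The inclusion of the space `P i` in the telescope. -/
def base (i : ℕ) : C(P i, Telescope f) :=
  ⟨fun x ↦ Quot.mk _ (Sum.inl ⟨i, x⟩),
    continuous_quot_mk.comp (continuous_inl.comp continuous_sigmaMk)⟩

/-- The `i`-th cylinder of the telescope. -/
def cyl (i : ℕ) : C(P (i + 1) × I, Telescope f) :=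
  ⟨fun x ↦ Quot.mk _ (Sum.inr ⟨i, x⟩),
    continuous_quot_mk.comp (continuous_inr.comp
      (continuous_sigmaMk : Continuous (Sigma.mk (β := fun i ↦ P (i + 1) × I) i)))⟩

@[simp]
theorem cyl_zero (i : ℕ) (x : P (i + 1)) : cyl f i (x, 0) = base f i (f i x) :=
  Quot.sound (.bottom i x)

@[simp]
theorem cyl_one (i : ℕ) (x : P (i + 1)) : cyl f i (x, 1) = base f (i + 1) x :=
  Quot.sound (.top i x)

variable {f}

theorem cases_base_cyl (z : Telescope f) :
    (∃ i x, z = base f i x) ∨ ∃ i x, ∃ t : I, 0 < (t : ℝ) ∧ (t : ℝ) < 1 ∧ z = cyl f i (x, t) := by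
  obtain ⟨⟨i, x⟩ | ⟨i, x, t⟩, rfl⟩ := Quot.exists_rep z
  · exact Or.inl ⟨i, x, rfl⟩
  · change _ ∨ ∃ j y, ∃ s : I, _ ∧ _ ∧ cyl f i (x, t) = _
    change (∃ j y, cyl f i (x, t) = base f j y) ∨ _
    rcases t.2.1.eq_or_lt with h0 | h0
    · obtain rfl : t = 0 := Subtype.ext h0.symm
      exact Or.inl ⟨i, f i x, cyl_zero ..⟩
    rcases t.2.2.eq_or_lt with h1 | h1
    · obtain rfl : t = 1 := Subtype.ext h1
      exact Or.inl ⟨i + 1, x, cyl_one ..⟩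
    exact Or.inr ⟨i, x, t, h0, h1, rfl⟩

theorem isOpen_iff {s : Set (Telescope f)} :
    IsOpen s ↔ (∀ i, IsOpen (base f i ⁻¹' s)) ∧ ∀ i, IsOpen (cyl f i ⁻¹' s) := by
  refine ⟨fun h ↦ ⟨fun i ↦ h.preimage (base f i).continuous,
    fun i ↦ h.preimage (cyl f i).continuous⟩, fun h ↦ ?_⟩
  refine isQuotientMap_quot_mk.isOpen_preimage.1 (isOpen_sum_iff.2 ⟨?_, ?_⟩)
  · exact isOpen_sigma_iff.2 h.1
  · exact (@isOpen_sigma_iff _ (fun i ↦ P (i + 1) × I) _ _).2 h.2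

/-- Continuous maps on the telescope are given by compatible maps on the spaces `P i` and on the
cylinders. -/
def lift {Z : Type*} [TopologicalSpace Z] (g : ∀ i, C(P i, Z)) (h : ∀ i, C(P (i + 1) × I, Z))
    (h₀ : ∀ i x, h i (x, 0) = g i (f i x)) (h₁ : ∀ i x, h i (x, 1) = g (i + 1) x) :
    C(Telescope f, Z) where
  toFun := Quot.lift (Sum.elim (fun x ↦ g x.1 x.2) fun x ↦ h x.1 x.2) (by
    rintro _ _ (⟨i, x⟩ | ⟨i, x⟩)
    · exact h₀ i x
    · exact h₁ i x)
  continuous_toFun := continuous_def.2 fun s hs ↦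
    isOpen_iff.2 ⟨fun i ↦ hs.preimage (g i).continuous, fun i ↦ hs.preimage (h i).continuous⟩

/-- The height of a point of the telescope: `i` on `P i`, and `i + t` at the level `t` of the `i`-th
cylinder. -/
def height : C(Telescope f, ℝ) :=
  lift (fun i ↦ .const _ i) (fun i ↦ ⟨fun x ↦ i + (x.2 : ℝ), by fun_prop⟩) (by simp) (by simp)

@[simp]
theorem height_base (i : ℕ) (x : P i) : height (base f i x) = i := rfl

@[simp]
theorem height_cyl (i : ℕ) (x : P (i + 1)) (t : I) : height (cyl f i (x, t)) = i + t := rfl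

theorem height_nonneg (z : Telescope f) : 0 ≤ height z := by
  rcases cases_base_cyl z with ⟨i, x, rfl⟩ | ⟨i, x, t, h0, h1, rfl⟩
  · simp
  · simp only [height_cyl]; positivity

theorem isCompact_height_le [∀ i, CompactSpace (P i)] (N : ℕ) :
    IsCompact {z : Telescope f | height z ≤ N} := by
  have h1 : IsCompact (⋃ i ∈ Finset.range (N + 1), (range (base f i) ∪ range (cyl f i))) :=
    (Finset.range (N + 1)).isCompact_biUnion fun i _ ↦
      (isCompact_range (base f i).continuous).union (isCompact_range (cyl f i).continuous)
  refine h1.of_isClosed_subset (isClosed_le height.continuous continuous_const) fun z hz ↦ ?_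
  simp only [mem_iUnion, Finset.mem_range]
  rcases cases_base_cyl z with ⟨i, x, rfl⟩ | ⟨i, x, t, h0, h1, rfl⟩
  · have : (i : ℝ) ≤ N := hz
    rw [Nat.cast_le] at this
    exact ⟨i, by omega, Or.inl ⟨x, rfl⟩⟩
  · have h2 : (i : ℝ) + t ≤ N := hz
    have : i ≤ N := by
      have : (i : ℝ) ≤ N := by linarith
      exact_mod_cast this
    exact ⟨i, by omega, Or.inr ⟨_, rfl⟩⟩

/-! ### The downward flow -/

variable (f) in
/-- The point `x` of `P i`, pushed down along the cylinders to the height `a`. It does not move if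
`i ≤ a`, and stops at `P 0` if `a ≤ 0`. -/
noncomputable def flowBase : ∀ i, P i → ℝ → Telescope f
  | 0, x, _ => base f 0 x
  | i + 1, x, a =>
    if (i : ℝ) ≤ a then cyl f i (x, projIcc 0 1 zero_le_one (a - i)) else flowBase i (f i x) a

theorem flowBase_of_le {i : ℕ} (x : P i) {a : ℝ} (h : i ≤ a) : flowBase f i x a = base f i x := by
  cases i with
  | zero => rfl
  | succ i =>
    push_cast at h
    rw [flowBase, if_pos (by linarith), projIcc_of_right_le _ (by linarith)]
    exact cyl_one ..

theorem continuous_flowBase (i : ℕ) : Continuous fun q : P i × ℝ ↦ flowBase f i q.1 q.2 := by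
  induction i with
  | zero => exact (base f 0).continuous.comp continuous_fst
  | succ i ih =>
    refine Continuous.if_le ?_ ?_ continuous_const continuous_snd ?_
    · have := continuous_projIcc (h := zero_le_one' ℝ)
      fun_prop
    · exact ih.comp (by fun_prop : Continuous fun q : P (i + 1) × ℝ ↦ (f i q.1, q.2))
    · rintro ⟨x, a⟩ (rfl : (i : ℝ) = a)
      simp only [sub_self, flowBase_of_le _ le_rfl]
      rw [projIcc_left]
      exact cyl_zero ..

variable (f) in
/-- The point `(x, t)` of the `i`-th cylinder, pushed down to the height `a`, or not moved if its
height is at most `a`. -/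
noncomputable def flowCyl (i : ℕ) (x : P (i + 1)) (t : I) (a : ℝ) : Telescope f :=
  if (i : ℝ) ≤ a then cyl f i (x, min t (projIcc 0 1 zero_le_one (a - i)))
  else flowBase f i (f i x) a

theorem continuous_flowCyl (i : ℕ) :
    Continuous fun q : (P (i + 1) × I) × ℝ ↦ flowCyl f i q.1.1 q.1.2 q.2 := by
  refine Continuous.if_le ?_ ?_ continuous_const continuous_snd ?_
  · have := continuous_projIcc (h := zero_le_one' ℝ)
    fun_prop
  · exact (continuous_flowBase i).comp
      (by fun_prop : Continuous fun q : (P (i + 1) × I) × ℝ ↦ (f i q.1.1, q.2))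
  · rintro ⟨⟨x, t⟩, a⟩ (rfl : (i : ℝ) = a)
    simp only [sub_self, flowBase_of_le _ le_rfl]
    rw [projIcc_left, show min t (⟨0, by simp⟩ : I) = 0 from min_eq_right unitInterval.nonneg']
    exact cyl_zero ..

/-- `flow z a` is the point `z` pushed down along the cylinders to the height `a`, or `z` itself if
its height is at most `a`. It is curried so that it can be defined on the quotient; joint continuity
is `continuous_flow`. -/
noncomputable def flow : C(Telescope f, C(ℝ, Telescope f)) :=
  lift (fun i ↦ ContinuousMap.curry ⟨fun q ↦ flowBase f i q.1 q.2, continuous_flowBase i⟩)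
    (fun i ↦ ContinuousMap.curry ⟨fun q ↦ flowCyl f i q.1.1 q.1.2 q.2, continuous_flowCyl i⟩)
    (fun i x ↦ by
      ext a
      change flowCyl f i x 0 a = flowBase f i (f i x) a
      unfold flowCyl
      split_ifs with h
      · rw [flowBase_of_le _ h, min_eq_left unitInterval.nonneg']
        exact cyl_zero ..
      · rfl)
    (fun i x ↦ by
      ext a
      change flowCyl f i x 1 a = flowBase f (i + 1) x a
      unfold flowCyl
      rw [flowBase, min_eq_right unitInterval.le_one'])

@[simp]
theorem flow_cyl (i : ℕ) (x : P (i + 1)) (t : I) (a : ℝ) :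
    flow (cyl f i (x, t)) a = flowCyl f i x t a := rfl

theorem continuous_flow : Continuous fun q : Telescope f × ℝ ↦ flow q.1 q.2 :=
  ContinuousMap.continuous_uncurry_of_continuous flow

theorem height_flowBase (i : ℕ) (x : P i) (a : ℝ) :
    height (flowBase f i x a) = max 0 (min a i) := by
  induction i with
  | zero => simp [flowBase]
  | succ i ih =>
    rw [flowBase]
    have hi : (0 : ℝ) ≤ i := i.cast_nonneg
    split_ifs with h
    · rw [height_cyl, coe_projIcc]
      push_cast
      grind
    · rw [ih]
      push_cast
      grind

theorem height_flow (z : Telescope f) (a : ℝ) : height (flow z a) = max 0 (min a (height z)) := by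
  rcases cases_base_cyl z with ⟨i, x, rfl⟩ | ⟨i, x, t, h0, h1, rfl⟩
  · exact height_flowBase i x a
  · rw [flow_cyl, flowCyl, height_cyl]
    have hi : (0 : ℝ) ≤ i := i.cast_nonneg
    split_ifs with h
    · rw [height_cyl, Set.Icc.coe_inf, coe_projIcc]
      grind
    · rw [height_flowBase]
      grind

theorem flow_of_height_le {z : Telescope f} {a : ℝ} (h : height z ≤ a) : flow z a = z := by
  rcases cases_base_cyl z with ⟨i, x, rfl⟩ | ⟨i, x, t, h0, h1, rfl⟩
  · exact flowBase_of_le x h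
  · rw [height_cyl] at h
    rw [flow_cyl, flowCyl, if_pos (by linarith), min_eq_left]
    rw [← Subtype.coe_le_coe, coe_projIcc]
    exact le_max_of_le_right (le_min h1.le (by linarith))

theorem flow_flowBase (i : ℕ) (x : P i) (a b : ℝ) :
    flow (flowBase f i x b) a = flowBase f i x (min a b) := by
  induction i with
  | zero => rfl
  | succ i ih =>
    simp only [flowBase, le_min_iff]
    by_cases h : (i : ℝ) ≤ b
    · rw [if_pos h, flow_cyl, flowCyl]
      simp only [h, and_true]
      split_ifs with h'
      · congr 2
        rw [← (monotone_projIcc (zero_le_one' ℝ)).map_min, min_sub_sub_right, min_comm]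
      · rw [min_eq_left (by linarith)]
    · rw [if_neg h, if_neg (by tauto), ih]

/-! ### The ray -/

variable (f) in
/-- The point of height `a` on the ray formed by the points `p i` and the segments of the cylinders
above them. It is obtained by pushing down any `p N` with `a ≤ N`, see `flowBase_vertex`. -/
noncomputable def ray (p : ∀ i, P i) (a : ℝ) : Telescope f := flowBase f ⌈a⌉₊ (p ⌈a⌉₊) a

section Ray

variable {p : ∀ i, P i}

theorem flowBase_vertex (hf : ∀ i, f i (p (i + 1)) = p i) {N : ℕ} {a : ℝ} (h : a ≤ N) :
    flowBase f N (p N) a = ray f p a := by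
  induction N, Nat.ceil_le.2 h using Nat.le_induction with
  | base => rfl
  | succ N hN ih =>
    have hN' : a ≤ N := Nat.ceil_le.1 hN
    rw [← ih hN', flowBase, hf]
    split_ifs with h1
    · obtain rfl : (N : ℝ) = a := le_antisymm h1 hN'
      rw [sub_self, projIcc_left, flowBase_of_le _ le_rfl]
      exact (cyl_zero f N _).trans (by rw [hf])
    · rfl

theorem continuous_ray (hf : ∀ i, f i (p (i + 1)) = p i) : Continuous (ray f p) := by
  refine continuous_iff_continuousAt.2 fun a ↦ ?_
  obtain ⟨N, hN⟩ := exists_nat_gt a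
  have h1 : Continuous fun b : ℝ ↦ flowBase f N (p N) b :=
    (continuous_flowBase (f := f) N).comp (by fun_prop : Continuous fun b : ℝ ↦ (p N, b))
  refine h1.continuousAt.congr ?_
  filter_upwards [Iio_mem_nhds hN] with b hb using flowBase_vertex hf (le_of_lt hb)

theorem height_ray {a : ℝ} (ha : 0 ≤ a) : height (ray f p a) = a := by
  rw [ray, height_flowBase, min_eq_left (Nat.le_ceil a), max_eq_right ha]

theorem flow_ray (hf : ∀ i, f i (p (i + 1)) = p i) (a b : ℝ) :
    flow (ray f p b) a = ray f p (min a b) := by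
  rw [ray, flow_flowBase, flowBase_vertex hf ((min_le_right _ _).trans (Nat.le_ceil b))]

theorem ray_natCast (i : ℕ) : ray f p i = base f i (p i) := by
  rw [ray, Nat.ceil_natCast, flowBase_of_le _ le_rfl]

theorem cyl_vertex (hf : ∀ i, f i (p (i + 1)) = p i) (i : ℕ) (t : I) :
    cyl f i (p (i + 1), t) = ray f p (i + t) := by
  have h0 := t.2.1
  have h1 := t.2.2
  rw [← flowBase_vertex hf (N := i + 1) (by push_cast; linarith), flowBase,
    if_pos (by linarith), add_sub_cancel_left, projIcc_val]

end Ray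

/-! ### Coordinates -/

section Coord

variable (p : ∀ i, P i)

/-- The identity of `P k` for `j = k`, and the constant map to `p k` for other `j`. -/
def coordBase (k j : ℕ) (x : P j) : P k := if h : j = k then h ▸ x else p k

omit [∀ i, TopologicalSpace (P i)] in
theorem coordBase_self (k : ℕ) (x : P k) : coordBase p k k x = x := by simp [coordBase]

theorem continuous_coordBase (k j : ℕ) : Continuous (coordBase p k j) := by
  by_cases h : j = k
  · subst h
    exact continuous_id.congr fun x ↦ (coordBase_self p j x).symm
  · have : coordBase p k j = fun _ ↦ p k := by
      ext x
      simp [coordBase, h]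
    rw [this]
    exact continuous_const

open Classical in
variable (f) in
/-- The restriction of `coord` to the `j`-th cylinder: the coordinate `x` if `j + 1 = k`, its image
`f j x` if `j = k`, and `p k` in all other cylinders. The value at the ends of the cylinder is the
one imposed by the identifications. -/
noncomputable def coordCyl (k j : ℕ) (x : P (j + 1)) (t : I) : P k :=
  if t = 0 ∨ t ≠ 1 ∧ j + 1 ≠ k then coordBase p k j (f j x) else coordBase p k (j + 1) x

/-- The `P k`-coordinate of a point of the telescope. It is meaningful at heights strictly between
`k - 1` and `k + 1`, where it is continuous, and is the junk value `p k` at other heights. -/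
noncomputable def coord (k : ℕ) : Telescope f → P k :=
  Quot.lift (Sum.elim (fun x ↦ coordBase p k x.1 x.2) fun x ↦ coordCyl f p k x.1 x.2.1 x.2.2) (by
    rintro _ _ (⟨i, x⟩ | ⟨i, x⟩)
    · simp [coordCyl]
    · simp [coordCyl])

@[simp]
theorem coord_base (k : ℕ) (x : P k) : coord p k (base f k x) = x := coordBase_self p k x

theorem coord_cyl (k : ℕ) (x : P (k + 1)) {t : I} (ht : 0 < (t : ℝ)) :
    coord p (k + 1) (cyl f k (x, t)) = x := by
  have h0 : t ≠ 0 := by rintro rfl; simp at ht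
  change coordCyl f p (k + 1) k x t = x
  simp [coordCyl, h0, coordBase_self]

theorem continuousOn_coord (k : ℕ) :
    ContinuousOn (coord (f := f) p k) {z | (k : ℝ) < height z + 1 ∧ height z < k + 1} := by
  have hU : IsOpen {z : Telescope f | (k : ℝ) < height z + 1 ∧ height z < k + 1} :=
    (isOpen_lt continuous_const (height.continuous.add continuous_const)).inter
      (isOpen_lt height.continuous continuous_const)
  refine (continuousOn_open_iff hU).2 fun O hO ↦ isOpen_iff.2 ⟨fun j ↦ ?_, fun j ↦ ?_⟩
  · exact (isOpen_const (p := (k : ℝ) < j + 1 ∧ (j : ℝ) < k + 1)).inter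
      (hO.preimage (continuous_coordBase p k j))
  · have hsub : ∀ x : P (j + 1), ∀ t : I, (x, t) ∈ cyl f j ⁻¹'
        ({z | (k : ℝ) < height z + 1 ∧ height z < k + 1} ∩ coord p k ⁻¹' O) ↔
        ((k : ℝ) < j + t + 1 ∧ (j : ℝ) + t < k + 1) ∧ coordCyl f p k j x t ∈ O :=
      fun x t ↦ Iff.rfl
    by_cases h1 : j + 1 = k
    · subst h1
      convert (isOpen_lt continuous_const (by fun_prop :
        Continuous fun q : P (j + 1) × I ↦ (q.2 : ℝ))).inter
        (hO.preimage ((continuous_coordBase p (j + 1) (j + 1)).comp continuous_fst)) using 1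
      pick_goal 2
      · exact 0
      ext ⟨x, t⟩
      rw [hsub]
      have h1 := t.2.2
      have h2 : 0 < (t : ℝ) → t ≠ 0 := by rintro h rfl; simp at h
      push_cast
      constructor
      · rintro ⟨⟨h3, -⟩, h4⟩
        have h5 : 0 < (t : ℝ) := by linarith
        refine ⟨h5, ?_⟩
        simpa [coordCyl, h2 h5] using h4
      · rintro ⟨h5 : 0 < (t : ℝ), h4⟩
        refine ⟨⟨by linarith, by linarith⟩, ?_⟩
        simpa [coordCyl, h2 h5] using h4
    by_cases h2 : j = k
    · subst h2
      convert (isOpen_lt (by fun_prop :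
        Continuous fun q : P (j + 1) × I ↦ (q.2 : ℝ)) continuous_const).inter
        (hO.preimage ((continuous_coordBase p j j).comp
          ((f j).continuous.comp continuous_fst))) using 1
      pick_goal 2
      · exact 1
      ext ⟨x, t⟩
      rw [hsub]
      have h0 := t.2.1
      have h2 : (t : ℝ) < 1 → t ≠ 1 := by rintro h rfl; simp at h
      constructor
      · rintro ⟨⟨-, h3⟩, h4⟩
        have h5 : (t : ℝ) < 1 := by linarith
        refine ⟨h5, ?_⟩
        simpa [coordCyl, h2 h5] using h4
      · rintro ⟨h5 : (t : ℝ) < 1, h4⟩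
        refine ⟨⟨by linarith, by linarith⟩, ?_⟩
        simpa [coordCyl, h2 h5] using h4
    · convert isOpen_empty
      ext ⟨x, t⟩
      rw [hsub]
      have h3 := t.2.1
      have h4 := t.2.2
      simp only [mem_empty_iff_false, iff_false]
      rintro ⟨⟨h5, h6⟩, -⟩
      have h7 : (k : ℝ) < (j + 2 : ℕ) := by push_cast; linarith
      have h8 : (j : ℝ) < (k + 1 : ℕ) := by push_cast; linarith
      rw [Nat.cast_lt] at h7 h8
      omega

theorem base_coord {z : Telescope f} {k : ℕ} (hz : height z = k) : base f k (coord p k z) = z := by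
  rcases cases_base_cyl z with ⟨i, x, rfl⟩ | ⟨i, x, t, h0, h1, rfl⟩
  · obtain rfl : i = k := Nat.cast_injective (hz : (i : ℝ) = k)
    rw [coord_base]
  · rw [height_cyl] at hz
    have h2 : (i : ℝ) < k := by linarith
    have h3 : (k : ℝ) < (i + 1 : ℕ) := by push_cast; linarith
    rw [Nat.cast_lt] at h2 h3
    omega

theorem cyl_coord {z : Telescope f} {k : ℕ} (h : k < height z) (h' : height z ≤ k + 1) :
    cyl f k (coord p (k + 1) z, projIcc 0 1 zero_le_one (height z - k)) = z := by
  rcases cases_base_cyl z with ⟨i, x, rfl⟩ | ⟨i, x, t, h0, h1, rfl⟩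
  · rw [height_base] at h h'
    obtain rfl : i = k + 1 := by
      have h2 : k < i := by exact_mod_cast h
      have h3 : i ≤ k + 1 := by exact_mod_cast h'
      omega
    rw [coord_base, projIcc_of_right_le _ (by simp)]
    exact cyl_one ..
  · rw [height_cyl] at h h'
    obtain rfl : i = k := by
      have h2 : (k : ℝ) < (i + 1 : ℕ) := by push_cast; linarith
      have h3 : (i : ℝ) < (k + 1 : ℕ) := by push_cast; linarith
      rw [Nat.cast_lt] at h2 h3
      omega
    rw [coord_cyl _ _ _ h0, height_cyl, add_sub_cancel_left, projIcc_val]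

end Coord

/-! ### The one-point compactification -/

/-- The height on the one-point compactification of the telescope, infinite at `∞`. -/
noncomputable def extHeight (x : OnePoint (Telescope f)) : ENNReal :=
  x.elim ⊤ fun z ↦ ENNReal.ofReal (height z)

@[simp]
theorem extHeight_infty : extHeight (OnePoint.infty : OnePoint (Telescope f)) = ⊤ := rfl

@[simp]
theorem extHeight_coe (z : Telescope f) :
    extHeight (z : OnePoint (Telescope f)) = ENNReal.ofReal (height z) := rfl

theorem extHeight_eq_top {x : OnePoint (Telescope f)} : extHeight x = ⊤ ↔ x = OnePoint.infty := by
  induction x using OnePoint.rec with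
  | infty => simp
  | coe z => simp

theorem continuous_extHeight [∀ i, CompactSpace (P i)] :
    Continuous (extHeight : OnePoint (Telescope f) → ENNReal) := by
  have h1 : Continuous fun z : Telescope f ↦ ENNReal.ofReal (height z) :=
    ENNReal.continuous_ofReal.comp height.continuous
  refine continuous_iff_continuousAt.2 fun x ↦ ?_
  induction x using OnePoint.rec with
  | infty =>
    refine OnePoint.continuousAt_infty'.2 (ENNReal.tendsto_nhds_top fun N ↦ ?_)
    refine mem_coclosedCompact_iff.2 ((isCompact_height_le N).of_isClosed_subset isClosed_closure
      (closure_minimal (fun z hz ↦ ?_) (isClosed_le height.continuous continuous_const)))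
    simpa using hz
  | coe z => exact OnePoint.continuousAt_coe.2 h1.continuousAt

/-- The neighbourhoods of `∞` are detected by the height, since the height is bounded on compact
sets. -/
theorem continuousAt_of_tendsto_extHeight {Z : Type*} [TopologicalSpace Z]
    {g : Z → OnePoint (Telescope f)} {z : Z} (hz : g z = OnePoint.infty)
    (h : Tendsto (fun y ↦ extHeight (g y)) (𝓝 z) (𝓝 ⊤)) : ContinuousAt g z := by
  rw [ContinuousAt, hz, OnePoint.hasBasis_nhds_infty.tendsto_right_iff]
  rintro s ⟨-, hs⟩
  obtain ⟨N, hN⟩ := (hs.image height.continuous).bddAbove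
  filter_upwards [h.eventually (lt_mem_nhds (ENNReal.ofReal_lt_top (r := N)))] with y hy
  generalize g y = x at hy
  induction x using OnePoint.rec with
  | infty => exact Or.inr rfl
  | coe w =>
    refine Or.inl ⟨w, fun hw ↦ ?_, rfl⟩
    rw [extHeight_coe] at hy
    exact hy.not_ge (ENNReal.ofReal_le_ofReal (hN ⟨w, hw, rfl⟩))

theorem tendsto_sub_ofReal_nhds_top {Z : Type*} {l : Filter Z} {q : Z → ENNReal}
    (hq : Tendsto q l (𝓝 ⊤)) (M : ℝ) :
    Tendsto (fun z ↦ q z - ENNReal.ofReal M) l (𝓝 ⊤) := by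
  have h := ((ENNReal.continuous_sub_right (ENNReal.ofReal M)).tendsto ⊤).comp hq
  simpa [Function.comp_def] using h

/-- The homotopy of the compactified telescope which pushes a point of height `r` down by `s * d r`
at time `s`, and fixes `∞`. -/
noncomputable def extFlow (d : ℝ → ℝ) (q : OnePoint (Telescope f) × I) : OnePoint (Telescope f) :=
  q.1.elim OnePoint.infty fun z ↦ (flow z (height z - q.2 * d (height z)) : Telescope f)

theorem continuous_extFlow [∀ i, CompactSpace (P i)] {d : ℝ → ℝ} (hd : Continuous d) {M : ℝ}
    (hM : 0 ≤ M) (hdM : ∀ r, d r ≤ M) :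
    Continuous (extFlow d : OnePoint (Telescope f) × I → OnePoint (Telescope f)) := by
  refine continuous_iff_continuousAt.2 fun ⟨x, s⟩ ↦ ?_
  induction x using OnePoint.rec with
  | infty =>
    refine continuousAt_of_tendsto_extHeight rfl ?_
    have h1 : Tendsto (fun q : OnePoint (Telescope f) × I ↦ extHeight q.1)
        (𝓝 (OnePoint.infty, s)) (𝓝 ⊤) := by
      have := (continuous_extHeight (f := f)).comp (continuous_fst (Y := I))
      exact this.tendsto (OnePoint.infty, s)
    refine tendsto_nhds_top_mono' (tendsto_sub_ofReal_nhds_top h1 M) fun ⟨x, s⟩ ↦ ?_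
    induction x using OnePoint.rec with
    | infty => simp [extFlow]
    | coe z =>
      simp only [extFlow, OnePoint.elim_some, extHeight_coe, height_flow]
      rw [← ENNReal.ofReal_sub _ hM]
      refine ENNReal.ofReal_le_ofReal (le_max_of_le_right (le_min ?_ (by linarith)))
      have h1 := s.2.1
      have h2 := s.2.2
      have h3 := hdM (height z)
      nlinarith
  | coe z =>
    refine ((OnePoint.isOpenEmbedding_coe.prodMap IsOpenEmbedding.id).continuousAt_iff
      (x := (z, s))).1 ?_
    have h1 : Continuous fun q : Telescope f × I ↦
        flow q.1 (height q.1 - q.2 * d (height q.1)) := by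
      have := continuous_flow.comp (by fun_prop : Continuous fun q : Telescope f × I ↦
        (q.1, height q.1 - q.2 * d (height q.1)))
      exact this
    exact (OnePoint.continuous_coe.comp h1).continuousAt

theorem homotopicRel_extFlow [∀ i, CompactSpace (P i)] {d : ℝ → ℝ} (hd : Continuous d) {M : ℝ}
    (hM : 0 ≤ M) (hdM : ∀ r, d r ≤ M) {Y : Type*} [TopologicalSpace Y]
    (h : C(Y, OnePoint (Telescope f))) {S : Set Y} (hS : ∀ y ∈ S, h y = OnePoint.infty) :
    ∃ g : C(Y, OnePoint (Telescope f)), (∀ y, g y = extFlow d (h y, 1)) ∧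
      h.HomotopicRel g S := by
  have hc := continuous_extFlow (f := f) hd hM hdM
  refine ⟨⟨fun y ↦ extFlow d (h y, 1), by fun_prop⟩, fun y ↦ rfl,
    ⟨⟨⟨⟨fun q ↦ extFlow d (h q.2, q.1), by fun_prop⟩, fun y ↦ ?_, fun y ↦ rfl⟩, fun s y hy ↦ ?_⟩⟩⟩
  · change extFlow d (h y, 0) = h y
    generalize h y = x
    induction x using OnePoint.rec with
    | infty => rfl
    | coe z => simp [extFlow, flow_of_height_le]
  · change extFlow d (h y, s) = h y
    rw [hS y hy]
    rfl

variable (f) in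
/-- The ray, with the point `∞` added at its end. -/
noncomputable def extRay (p : ∀ i, P i) (r : ENNReal) : OnePoint (Telescope f) :=
  open Classical in if r = ⊤ then OnePoint.infty else (ray f p r.toReal : Telescope f)

/-- The point `x` is on the ray, or is `∞`. -/
def OnRay (p : ∀ i, P i) (x : OnePoint (Telescope f)) : Prop := extRay f p (extHeight x) = x

section Ray

variable {p : ∀ i, P i}

theorem extHeight_extRay (r : ENNReal) : extHeight (extRay f p r) = r := by
  unfold extRay
  split_ifs with h
  · simp [h]
  · rw [extHeight_coe, height_ray ENNReal.toReal_nonneg, ENNReal.ofReal_toReal h]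

theorem onRay_infty : OnRay p (OnePoint.infty : OnePoint (Telescope f)) := by
  simp [OnRay, extRay]

theorem onRay_coe {z : Telescope f} : OnRay p (z : OnePoint (Telescope f)) ↔
    ray f p (height z) = z := by
  simp [OnRay, extRay, height_nonneg z]

theorem continuous_extRay [∀ i, CompactSpace (P i)] (hf : ∀ i, f i (p (i + 1)) = p i) :
    Continuous (extRay f p) := by
  refine continuous_iff_continuousAt.2 fun r ↦ ?_
  by_cases hr : r = ⊤
  · refine continuousAt_of_tendsto_extHeight (by simp [extRay, hr]) ?_
    simp only [extHeight_extRay, hr]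
    exact tendsto_id
  · have h1 : ContinuousAt (fun r : ENNReal ↦ ((ray f p r.toReal : Telescope f) :
        OnePoint (Telescope f))) r :=
      (OnePoint.continuous_coe.comp (continuous_ray hf)).continuousAt.comp
        (ENNReal.continuousAt_toReal hr)
    refine h1.congr ?_
    filter_upwards [isOpen_ne.mem_nhds hr] with r' hr'
    simp [extRay, show r' ≠ ⊤ from hr']

theorem onRay_extFlow (hf : ∀ i, f i (p (i + 1)) = p i) {d : ℝ → ℝ} {x : OnePoint (Telescope f)}
    (hx : OnRay p x) (s : I) (hd : ∀ r, 0 ≤ d r) : OnRay p (extFlow d (x, s)) := by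
  induction x using OnePoint.rec with
  | infty => exact onRay_infty
  | coe z =>
    rw [onRay_coe] at hx
    simp only [extFlow, OnePoint.elim_some, onRay_coe]
    have h1 : height z - s * d (height z) ≤ height z := by
      nlinarith [s.2.1, hd (height z), mul_nonneg s.2.1 (hd (height z))]
    have h0 := height_nonneg z
    generalize height z - s * d (height z) = a at h1
    rw [height_flow, min_eq_left h1, ← hx, flow_ray hf, min_eq_left h1]
    rcases le_total 0 a with ha | ha
    · rw [max_eq_right ha]
    · rw [max_eq_left ha, ray, ray, Nat.ceil_eq_zero.2 ha, Nat.ceil_eq_zero.2 le_rfl]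
      rfl

/-- Points of the ray are moved up: at time `s` all are at height at least `1 / (1 - s) - 1`. -/
theorem homotopicRel_infty_of_onRay [∀ i, CompactSpace (P i)]
    (hf : ∀ i, f i (p (i + 1)) = p i) {Y : Type*} [TopologicalSpace Y]
    (h : C(Y, OnePoint (Telescope f))) (hray : ∀ y, OnRay p (h y)) {S : Set Y}
    (hS : ∀ y ∈ S, h y = OnePoint.infty) :
    h.HomotopicRel (ContinuousMap.const Y OnePoint.infty) S := by
  have h1 := continuous_extRay hf
  have h2 := continuous_extHeight (f := f)
  have h3 : Continuous fun s : I ↦ (ENNReal.ofReal (1 - s))⁻¹ - 1 :=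
    (ENNReal.continuous_sub_right 1).comp (continuous_inv.comp
      (ENNReal.continuous_ofReal.comp (by fun_prop)))
  refine ⟨⟨⟨⟨fun q ↦ extRay f p (max (extHeight (h q.2)) ((ENNReal.ofReal (1 - q.1))⁻¹ - 1)),
    h1.comp ((h2.comp (by fun_prop)).max (h3.comp continuous_fst))⟩, fun y ↦ ?_, fun y ↦ ?_⟩,
    fun s y hy ↦ ?_⟩⟩
  · simpa [OnRay] using hray y
  · simp [extRay]
  · simp [hS y hy, extRay]

end Ray

/-! ### Gluing homotopies over strips of heights -/

open Classical in
/-- Homotopies `H i` of the map `h` over the strips `R i` of points with `q` between `i + α` and `i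
+ β`, for `i ≥ m`, fit together to a homotopy of `h`, stationary elsewhere, if they are stationary
at the ends of the strips. Away from `q = ⊤` the strips are locally finite; at `q = ⊤` continuity
follows from the bound `H_height` on the heights. Here `q` need not be the height of `h`, but may be
the height of another map, from which `h` was obtained. -/
theorem exists_glue_homotopy [∀ i, CompactSpace (P i)] {Y : Type*} [TopologicalSpace Y]
    (h : C(Y, OnePoint (Telescope f))) (q : C(Y, ENNReal))
    (hq : ∀ y, q y = ⊤ → h y = OnePoint.infty) {α β : ℝ} (h0 : 0 ≤ α)
    (hβ : β < α + 1) (m : ℕ) (R : ℕ → Set Y)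
    (hR : ∀ i, R i = {y | m ≤ i ∧ ENNReal.ofReal (i + α) ≤ q y ∧ q y ≤ ENNReal.ofReal (i + β)})
    (H : ∀ i, C(R i × I, Telescope f))
    (H_zero : ∀ i y, (H i (y, 0) : OnePoint (Telescope f)) = h y)
    (H_bd : ∀ (i : ℕ) (y : R i) s, q y = ENNReal.ofReal (i + α) ∨ q y = ENNReal.ofReal (i + β) →
      (H i (y, s) : OnePoint (Telescope f)) = h y)
    (H_height : ∀ (i : ℕ) y s, (i : ℝ) ≤ height (H i (y, s))) :
    ∃ G : C(Y × I, OnePoint (Telescope f)), (∀ y, G (y, 0) = h y) ∧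
      (∀ i (y : R i) s, G (y, s) = H i (y, s)) ∧ ∀ y s, (∀ i, y ∉ R i) → G (y, s) = h y := by
  have hlt : ∀ i j : ℕ, i < j → ENNReal.ofReal (i + β) < ENNReal.ofReal (j + α) := by
    intro i j hij
    have h1 : (i : ℝ) + 1 ≤ j := by exact_mod_cast hij
    exact (ENNReal.ofReal_lt_ofReal_iff (by linarith [i.cast_nonneg (α := ℝ)])).2 (by linarith)
  have huniq : ∀ i j y, y ∈ R i → y ∈ R j → i = j := by
    intro i j y hi hj
    rw [hR] at hi hj
    obtain ⟨-, hi1, hi2⟩ := hi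
    obtain ⟨-, hj1, hj2⟩ := hj
    by_contra hne
    rcases Nat.lt_or_gt_of_ne hne with hij | hij
    · exact (hlt _ _ hij).not_ge (hj1.trans hi2)
    · exact (hlt _ _ hij).not_ge (hi1.trans hj2)
  let G : Y × I → OnePoint (Telescope f) := fun x ↦
    if hx : ∃ i, x.1 ∈ R i then H hx.choose (⟨x.1, hx.choose_spec⟩, x.2) else h x.1
  have hGR : ∀ i (y : R i) s, G (y, s) = H i (y, s) := by
    intro i y s
    have hx : ∃ i, (y : Y) ∈ R i := ⟨i, y.2⟩
    simp only [G, dif_pos hx]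
    have : ∀ j (hj : (y : Y) ∈ R j), (H j (⟨y, hj⟩, s)) = H i (y, s) := by
      intro j hj
      obtain rfl := huniq _ _ _ hj y.2
      rfl
    rw [this]
  have hGn : ∀ y s, (∀ i, y ∉ R i) → G (y, s) = h y := fun y s hy ↦
    dif_neg (not_exists.2 hy)
  have hRclosed : ∀ i, IsClosed (R i) := by
    intro i
    rw [hR]
    exact isClosed_const.inter ((isClosed_le continuous_const q.continuous).inter
      (isClosed_le q.continuous continuous_const))
  have hcR : ∀ i, ContinuousOn G (R i ×ˢ univ) := by
    intro i
    rw [continuousOn_iff_continuous_domRestrict]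
    have h1 : Continuous fun x : ↥(R i ×ˢ (univ : Set I)) ↦
        ((H i (⟨x.1.1, x.2.1⟩, x.1.2) : Telescope f) : OnePoint (Telescope f)) :=
      OnePoint.continuous_coe.comp ((H i).continuous.comp (by fun_prop))
    exact h1.congr fun x ↦ (hGR i ⟨x.1.1, x.2.1⟩ x.1.2).symm
  -- off the open strips the homotopy is stationary
  let S : Set Y := {y | ∀ i, m ≤ i →
    ¬ (ENNReal.ofReal (i + α) < q y ∧ q y < ENNReal.ofReal (i + β))}
  have hSclosed : IsClosed S := by
    have : S = ⋂ i, ⋂ _ : m ≤ i, {y | ENNReal.ofReal (i + α) < q y ∧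
        q y < ENNReal.ofReal (i + β)}ᶜ := by
      ext y; simp [S]
    rw [this]
    exact isClosed_iInter fun i ↦ isClosed_iInter fun _ ↦ (((isOpen_lt continuous_const
      q.continuous).inter (isOpen_lt q.continuous continuous_const))).isClosed_compl
  have hGS : ∀ y ∈ S, ∀ s, G (y, s) = h y := by
    intro y hy s
    by_cases hx : ∃ i, y ∈ R i
    · obtain ⟨i, hi⟩ := hx
      rw [hGR i ⟨y, hi⟩ s]
      refine H_bd i ⟨y, hi⟩ s ?_
      rw [hR] at hi
      obtain ⟨h1, h2, h3⟩ := hi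
      by_contra! h4
      exact hy i h1 ⟨lt_of_le_of_ne h2 h4.1.symm, lt_of_le_of_ne h3 h4.2⟩
    · exact hGn y s (not_exists.1 hx)
  have hcS : ContinuousOn G (S ×ˢ univ) :=
    (h.continuous.comp continuous_fst).continuousOn.congr fun x hx ↦ hGS x.1 hx.1 x.2
  have hGc : Continuous G := by
    refine continuous_iff_continuousAt.2 fun ⟨y₀, s₀⟩ ↦ ?_
    by_cases hy₀ : q y₀ = ⊤
    · have hh := hq _ hy₀
      have hS₀ : y₀ ∈ S := fun i _ h ↦ by simp [hy₀] at h
      refine continuousAt_of_tendsto_extHeight ((hGS y₀ hS₀ s₀).trans hh) ?_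
      have t1 : Tendsto (fun x : Y × I ↦ q x.1) (𝓝 (y₀, s₀)) (𝓝 ⊤) := by
        have : Continuous fun x : Y × I ↦ q x.1 := by fun_prop
        simpa [hy₀] using this.tendsto (y₀, s₀)
      have t2 : Tendsto (fun x : Y × I ↦ extHeight (h x.1)) (𝓝 (y₀, s₀)) (𝓝 ⊤) := by
        have : Continuous fun x : Y × I ↦ extHeight (h x.1) :=
          continuous_extHeight.comp (by fun_prop)
        simpa [hh] using this.tendsto (y₀, s₀)
      have t3 := t2.min (tendsto_sub_ofReal_nhds_top t1 (max 0 β))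
      rw [min_self] at t3
      refine tendsto_nhds_top_mono' t3 fun ⟨y, s⟩ ↦ ?_
      by_cases hx : ∃ i, y ∈ R i
      · obtain ⟨i, hi⟩ := hx
        refine (min_le_right _ _).trans ?_
        change _ ≤ extHeight (G ((⟨y, hi⟩ : R i), s))
        rw [hGR, extHeight_coe, tsub_le_iff_right, ← ENNReal.ofReal_add (height_nonneg _)
          (le_max_left _ _)]
        have hi' := hi
        rw [hR] at hi'
        exact hi'.2.2.trans (ENNReal.ofReal_le_ofReal
          (add_le_add (H_height i ⟨y, hi⟩ s) (le_max_right _ _)))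
      · refine (min_le_left _ _).trans ?_
        rw [hGn y s (not_exists.1 hx)]
    · obtain ⟨N, hN⟩ := ENNReal.exists_nat_gt hy₀
      let F : Option (Fin N) → Set (Y × I) := fun i ↦
        i.elim (S ×ˢ univ) fun i ↦ R i ×ˢ univ
      have hF : ContinuousOn G (⋃ i, F i) := by
        refine (locallyFinite_of_finite F).continuousOn_iUnion ?_ ?_
        · rintro (_ | i)
          · exact hSclosed.prod isClosed_univ
          · exact (hRclosed i).prod isClosed_univ
        · rintro (_ | i)
          · exact hcS
          · exact hcR i
      refine hF.continuousAt ?_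
      have hV : IsOpen {x : Y × I | q x.1 < N} :=
        isOpen_lt (by fun_prop) continuous_const
      filter_upwards [hV.mem_nhds hN] with ⟨y, s⟩ hy
      by_cases hyS : y ∈ S
      · exact mem_iUnion.2 ⟨none, hyS, trivial⟩
      · simp only [S, mem_ofPred_eq, not_forall, not_not] at hyS
        obtain ⟨i, hi, h1, h2⟩ := hyS
        have hiN : i < N := by
          by_contra! hNi
          have h3 : (N : ENNReal) ≤ ENNReal.ofReal (i + α) := by
            rw [← ENNReal.ofReal_natCast]
            refine ENNReal.ofReal_le_ofReal ?_
            have : (N : ℝ) ≤ i := by exact_mod_cast hNi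
            linarith
          exact (h1.trans hy).not_ge h3
        refine mem_iUnion.2 ⟨some ⟨i, hiN⟩, ?_, trivial⟩
        change y ∈ R i
        rw [hR]
        exact ⟨hi, h1.le, h2.le⟩
  refine ⟨⟨G, hGc⟩, fun y ↦ ?_, hGR, hGn⟩
  by_cases hx : ∃ i, y ∈ R i
  · obtain ⟨i, hi⟩ := hx
    exact (hGR i ⟨y, hi⟩ 0).trans (H_zero i ⟨y, hi⟩)
  · exact hGn y 0 (not_exists.1 hx)

/-! ### Deformation to the ray -/

/-- The points of height between `i + α` and `i + β`; empty for `i < m`. -/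
def strip (m : ℕ) (α β : ℝ) (i : ℕ) : Set (OnePoint (Telescope f)) :=
  {x | m ≤ i ∧ ENNReal.ofReal (i + α) ≤ extHeight x ∧ extHeight x ≤ ENNReal.ofReal (i + β)}

theorem isClosed_strip [∀ i, CompactSpace (P i)] (m : ℕ) (α β : ℝ) (i : ℕ) :
    IsClosed (strip (f := f) m α β i) :=
  isClosed_const.inter ((isClosed_le continuous_const continuous_extHeight).inter
    (isClosed_le continuous_extHeight continuous_const))

theorem exists_of_mem_strip {m : ℕ} {α β : ℝ} {i : ℕ} (hβ : 0 ≤ β)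
    {x : OnePoint (Telescope f)} (hx : x ∈ strip m α β i) :
    ∃ z : Telescope f, x = z ∧ m ≤ i ∧ i + α ≤ height z ∧ height z ≤ i + β := by
  obtain ⟨h1, h2, h3⟩ := hx
  induction x using OnePoint.rec with
  | infty => simp at h3
  | coe z =>
    exact ⟨z, rfl, h1, (ENNReal.ofReal_le_ofReal_iff (height_nonneg z)).1 h2,
      (ENNReal.ofReal_le_ofReal_iff (by positivity)).1 h3⟩

theorem coe_mem_strip {m : ℕ} {α β : ℝ} {i : ℕ} {z : Telescope f} (hm : m ≤ i)
    (h1 : i + α ≤ height z) (h2 : height z ≤ i + β) :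
    (z : OnePoint (Telescope f)) ∈ strip m α β i :=
  ⟨hm, ENNReal.ofReal_le_ofReal h1, ENNReal.ofReal_le_ofReal h2⟩

/-- The `P k`-coordinate on the compactified telescope, with the junk value `p k` at `∞`. -/
noncomputable def extCoord (p : ∀ i, P i) (k : ℕ) (x : OnePoint (Telescope f)) : P k :=
  x.elim (p k) (coord p k)

theorem continuousAt_extCoord (p : ∀ i, P i) {k : ℕ} {z : Telescope f}
    (h1 : (k : ℝ) < height z + 1) (h2 : height z < k + 1) :
    ContinuousAt (extCoord (f := f) p k) z := by
  refine OnePoint.continuousAt_coe.2 ((continuousOn_coord p k).continuousAt (IsOpen.mem_nhds ?_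
    ⟨h1, h2⟩))
  exact (isOpen_lt continuous_const (height.continuous.add continuous_const)).inter
      (isOpen_lt height.continuous continuous_const)

section Contraction

variable [∀ i, CompactSpace (P i)] {p : ∀ i, P i} {Y : Type*} [TopologicalSpace Y] {m : ℕ}

/-- The first deformation: the middle parts of the cylinders above height `m` are moved to the ray.
The contraction takes place over the strips from `i + 1 / 6` to `i + 5 / 6`, is complete over those
from `i + 1 / 3` to `i + 2 / 3`, and is damped in between by the factor `lam`. -/
theorem exists_onRay_middle (hf : ∀ i, f i (p (i + 1)) = p i)
    (hP : ∀ i, m ≤ i → ∀ (A : Set Y), IsClosed A → ∀ (u : C(A, P i)) (S : Set A),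
      (∀ a ∈ S, u a = p i) → u.HomotopicRel (ContinuousMap.const A (p i)) S)
    (h : C(Y, OnePoint (Telescope f))) {S : Set Y} (hS : ∀ y ∈ S, h y = OnePoint.infty) :
    ∃ g : C(Y, OnePoint (Telescope f)), h.HomotopicRel g S ∧
      ∀ i y, g y ∈ strip m (1 / 3) (2 / 3) i → OnRay p (g y) := by
  let R : ℕ → Set Y := fun i ↦ h ⁻¹' strip m (1 / 6) (5 / 6) i
  have hRc : ∀ i, IsClosed (R i) := fun i ↦ (isClosed_strip _ _ _ _).preimage h.continuous
  have hRz : ∀ i (y : R i), ∃ z : Telescope f, h y = z ∧ m ≤ i ∧ i + 1 / 6 ≤ height z ∧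
      height z ≤ i + 5 / 6 := fun i y ↦ exists_of_mem_strip (by norm_num) y.2
  let q : C(Y, ENNReal) := ⟨fun y ↦ extHeight (h y), continuous_extHeight.comp h.continuous⟩
  have hr : ∀ i, Continuous fun y : R i ↦ (q y).toReal := by
    intro i
    refine continuous_iff_continuousAt.2 fun y ↦ ?_
    refine (ENNReal.continuousAt_toReal ?_).comp (q.continuous.comp
      continuous_subtype_val).continuousAt
    obtain ⟨z, hz, -⟩ := hRz i y
    simp [q, hz]
  have hu : ∀ i, Continuous fun y : R i ↦ extCoord p (i + 1) (h y) := by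
    intro i
    refine continuous_iff_continuousAt.2 fun y ↦ ?_
    obtain ⟨z, hz, -, h1, h2⟩ := hRz i y
    refine ContinuousAt.comp (f := fun y : R i ↦ h y) (g := extCoord p (i + 1)) ?_
      (h.continuous.comp continuous_subtype_val).continuousAt
    rw [hz]
    exact continuousAt_extCoord p (by push_cast; linarith) (by push_cast; linarith)
  have hK : ∀ i, ∃ K : C(I × R i, P (i + 1)), (∀ y, K (0, y) = extCoord p (i + 1) (h y)) ∧
      ∀ y, K (1, y) = p (i + 1) := by
    intro i
    by_cases hi : m ≤ i
    · obtain ⟨K⟩ := hP (i + 1) (by omega) (R i) (hRc i) ⟨_, hu i⟩ ∅ (by simp)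
      exact ⟨K.toContinuousMap, fun y ↦ K.apply_zero y, fun y ↦ K.apply_one y⟩
    · have : IsEmpty (R i) := ⟨fun y ↦ hi y.2.1⟩
      exact ⟨⟨fun x ↦ p (i + 1), continuous_const⟩, fun y ↦ isEmptyElim y, fun y ↦ isEmptyElim y⟩
  choose K hK0 hK1 using hK
  have hpc := continuous_projIcc (h := zero_le_one' ℝ)
  let lam : ∀ i, C(R i, I) := fun i ↦ ⟨fun y ↦ projIcc 0 1 zero_le_one
    (min (6 * ((q y).toReal - i) - 1) (5 - 6 * ((q y).toReal - i))), by
      have := hr i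
      fun_prop⟩
  let H : ∀ i, C(R i × I, Telescope f) := fun i ↦
    ⟨fun x ↦ cyl f i (K i (x.2 * lam i x.1, x.1),
      projIcc 0 1 zero_le_one ((q x.1).toReal - i)), by
      have h1 : Continuous fun x : R i × I ↦ (q x.1).toReal := (hr i).comp continuous_fst
      exact (cyl f i).continuous.comp (((K i).continuous.comp ((continuous_snd.mul
        ((lam i).continuous.comp continuous_fst)).prodMk continuous_fst)).prodMk
        (hpc.comp (by fun_prop)))⟩
  have hH : ∀ i (y : R i) z s, h y = (z : Telescope f) → H i (y, s) = cyl f i (K i (s * lam i y, y),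
      projIcc 0 1 zero_le_one (height z - i)) := by
    intro i y z s hz
    simp [H, q, hz, height_nonneg]
  have hlam : ∀ i (y : R i) z, h y = (z : Telescope f) → lam i y = projIcc 0 1 zero_le_one
      (min (6 * (height z - i) - 1) (5 - 6 * (height z - i))) := by
    intro i y z hz
    simp [lam, q, hz, height_nonneg]
  have H_of_zero : ∀ i (y : R i) s, s * lam i y = 0 →
      (H i (y, s) : OnePoint (Telescope f)) = h y := by
    intro i y s hs
    obtain ⟨z, hz, -, h1, h2⟩ := hRz i y
    rw [hH i y z s hz, hs, hK0, hz]
    exact congrArg _ (cyl_coord p (by linarith) (by linarith))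
  obtain ⟨G, hG0, hGR, hGn⟩ := exists_glue_homotopy h q (fun y hy ↦ extHeight_eq_top.1 hy)
    (α := 1 / 6) (β := 5 / 6) (by norm_num) (by norm_num) m R (fun i ↦ rfl) H
    (fun i y ↦ H_of_zero i y 0 (zero_mul _))
    (fun i y s hy ↦ H_of_zero i y s (by
      obtain ⟨z, hz, -, h1, h2⟩ := hRz i y
      simp only [q, ContinuousMap.coe_mk, hz, extHeight_coe] at hy
      rw [ENNReal.ofReal_eq_ofReal_iff (height_nonneg _) (by positivity),
        ENNReal.ofReal_eq_ofReal_iff (height_nonneg _) (by positivity)] at hy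
      rw [hlam i y z hz, projIcc_of_le_left]
      · exact mul_zero s
      · rcases hy with hy | hy
        · exact min_le_of_left_le (by linarith)
        · exact min_le_of_right_le (by linarith)))
    (fun i y s ↦ by
      simp only [H, ContinuousMap.coe_mk, height_cyl]
      linarith [(projIcc 0 1 (zero_le_one' ℝ) ((q y).toReal - i)).2.1])
  refine ⟨⟨fun y ↦ G (y, 1), by fun_prop⟩, ⟨⟨⟨⟨fun x ↦ G (x.2, x.1), by fun_prop⟩, hG0,
    fun y ↦ rfl⟩, fun s y hy ↦ hGn y s fun i hi ↦ ?_⟩⟩, fun i y hy ↦ ?_⟩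
  · obtain ⟨z, hz, -⟩ := hRz i ⟨y, hi⟩
    exact OnePoint.coe_ne_infty z (hz.symm.trans (hS y hy))
  · simp only [ContinuousMap.coe_mk] at hy ⊢
    by_cases hx : ∃ j, y ∈ R j
    · obtain ⟨j, hj⟩ := hx
      obtain ⟨z, hz, hmj, h1, h2⟩ := hRz j ⟨y, hj⟩
      have h3 := hGR j ⟨y, hj⟩ 1
      rw [hH j ⟨y, hj⟩ z 1 hz] at h3
      simp only [h3] at hy ⊢
      obtain ⟨w, hw, -, h4, h5⟩ := exists_of_mem_strip (by norm_num) hy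
      rw [OnePoint.coe_eq_coe] at hw
      rw [← hw, height_cyl, projIcc_of_mem _ ⟨by linarith, by linarith⟩] at h4 h5
      simp only [add_sub_cancel] at h4 h5
      obtain rfl : i = j := by
        have h6 : (i : ℝ) < (j + 1 : ℕ) := by push_cast; linarith
        have h7 : (j : ℝ) < (i + 1 : ℕ) := by push_cast; linarith
        rw [Nat.cast_lt] at h6 h7
        omega
      rw [hlam i ⟨y, hj⟩ z hz, projIcc_of_right_le _ (le_min (by linarith) (by linarith))]
      have h8 : (1 : I) * ⟨1, by simp⟩ = 1 := one_mul (1 : I)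
      rw [h8, hK1, cyl_vertex hf, onRay_coe, height_ray]
      have := (projIcc 0 1 (zero_le_one' ℝ) (height z - i)).2.1
      positivity
    · exfalso
      rw [hGn y 1 (not_exists.1 hx)] at hy
      obtain ⟨z, hz, h1, h2, h3⟩ := exists_of_mem_strip (by norm_num) hy
      refine hx ⟨i, ?_⟩
      change h y ∈ strip m (1 / 6) (5 / 6) i
      rw [hz]
      exact coe_mem_strip h1 (by linarith) (by linarith)

end Contraction

/-- The distance by which points are pushed down in order to collapse the strips around integral
heights: it makes `r - descent r` equal to `i` for `r` between `i + 2 / 3` and `i + 4 / 3`. -/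
noncomputable def descent (r : ℝ) : ℝ := 1 + Int.fract r - max 0 (min 1 (3 * Int.fract r - 1))

theorem continuous_descent : Continuous descent := by
  have h : ContinuousOn (fun t : ℝ ↦ 1 + t - max 0 (min 1 (3 * t - 1))) (Icc 0 1) := by
    fun_prop
  exact h.comp_fract'' (by norm_num)

theorem descent_nonneg (r : ℝ) : 0 ≤ descent r := by
  have h1 := Int.fract_nonneg r
  have h2 : max 0 (min 1 (3 * Int.fract r - 1)) ≤ 1 := max_le zero_le_one (min_le_left _ _)
  unfold descent
  linarith

theorem descent_le (r : ℝ) : descent r ≤ 2 := by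
  have h1 := (Int.fract_lt_one r).le
  have h2 := le_max_left 0 (min 1 (3 * Int.fract r - 1))
  unfold descent
  linarith

theorem sub_descent {r : ℝ} {i : ℕ} (h1 : i + 2 / 3 ≤ r) (h2 : r ≤ i + 4 / 3) :
    r - descent r = i := by
  unfold descent
  rcases lt_or_ge r (i + 1) with h | h
  · have hfr : Int.fract r = r - i := by
      rw [Int.fract_eq_iff]
      exact ⟨by linarith, by linarith, i, by simp⟩
    rw [hfr, min_eq_left (by linarith), max_eq_right zero_le_one]
    ring
  · have hfr : Int.fract r = r - (i + 1) := by
      rw [Int.fract_eq_iff]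
      exact ⟨by linarith, by linarith, i + 1, by push_cast; ring⟩
    rw [hfr, max_eq_left (min_le_of_right_le (by linarith))]
    ring

theorem extHeight_extFlow_le (d : ℝ → ℝ) (x : OnePoint (Telescope f)) (s : I) :
    extHeight (extFlow d (x, s)) ≤ extHeight x := by
  induction x using OnePoint.rec with
  | infty => simp
  | coe z =>
    simp only [extFlow, OnePoint.elim_some, extHeight_coe, height_flow]
    exact ENNReal.ofReal_le_ofReal (max_le (height_nonneg z) (min_le_right _ _))

variable [∀ i, CompactSpace (P i)] {p : ∀ i, P i} {Y : Type*} [TopologicalSpace Y] {m : ℕ}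

/-- The second deformation. Once the middle parts of the cylinders are on the ray, the strips from
`i + 2 / 3` to `i + 4 / 3` are pushed down to the space `P i` and contracted there to `p i`,
relative to the ends of the strips. -/
theorem exists_onRay_or_extHeight_le (hf : ∀ i, f i (p (i + 1)) = p i)
    (hP : ∀ i, m ≤ i → ∀ (A : Set Y), IsClosed A → ∀ (u : C(A, P i)) (S : Set A),
      (∀ a ∈ S, u a = p i) → u.HomotopicRel (ContinuousMap.const A (p i)) S)
    (h : C(Y, OnePoint (Telescope f))) {S : Set Y} (hS : ∀ y ∈ S, h y = OnePoint.infty)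
    (hray : ∀ i y, h y ∈ strip m (1 / 3) (2 / 3) i → OnRay p (h y)) :
    ∃ g : C(Y, OnePoint (Telescope f)), h.HomotopicRel g S ∧
      ∀ y, OnRay p (g y) ∨ extHeight (g y) ≤ ENNReal.ofReal (m + 1) := by
  -- `h'` maps the strip `R i` of `h` to `P i`
  obtain ⟨h', hh', hhom⟩ := homotopicRel_extFlow continuous_descent zero_le_two descent_le h hS
  have hray' : ∀ y, OnRay p (h y) → OnRay p (h' y) := fun y hy ↦
    hh' y ▸ onRay_extFlow hf hy 1 descent_nonneg
  let R : ℕ → Set Y := fun i ↦ h ⁻¹' strip m (2 / 3) (4 / 3) i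
  have hRc : ∀ i, IsClosed (R i) := fun i ↦ (isClosed_strip _ _ _ _).preimage h.continuous
  have hRz : ∀ i (y : R i), ∃ z : Telescope f, h y = z ∧ m ≤ i ∧ i + 2 / 3 ≤ height z ∧
      height z ≤ i + 4 / 3 := fun i y ↦ exists_of_mem_strip (by norm_num) y.2
  have hRz' : ∀ i (y : R i), ∃ z : Telescope f, h' y = z ∧ height z = i := by
    intro i y
    obtain ⟨z, hz, -, h1, h2⟩ := hRz i y
    refine ⟨flow z i, ?_, ?_⟩
    · rw [hh', hz, extFlow, OnePoint.elim_some, Set.Icc.coe_one, one_mul, sub_descent h1 h2]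
    · rw [height_flow, min_eq_left (by linarith), max_eq_right i.cast_nonneg]
  have hu : ∀ i, Continuous fun y : R i ↦ extCoord p i (h' y) := by
    intro i
    refine continuous_iff_continuousAt.2 fun y ↦ ?_
    obtain ⟨z, hz, h1⟩ := hRz' i y
    refine ContinuousAt.comp (f := fun y : R i ↦ h' y) (g := extCoord p i) ?_
      (h'.continuous.comp continuous_subtype_val).continuousAt
    rw [hz]
    exact continuousAt_extCoord p (by linarith) (by linarith)
  have hbase : ∀ i (y : R i), (base f i (extCoord p i (h' y)) : OnePoint (Telescope f)) = h' y := by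
    intro i y
    obtain ⟨z, hz, h1⟩ := hRz' i y
    rw [hz]
    exact congrArg _ (base_coord p h1)
  have hK : ∀ i, ∃ K : C(I × R i, P i), (∀ y, K (0, y) = extCoord p i (h' y)) ∧
      (∀ y, K (1, y) = p i) ∧ ∀ s (y : R i), extCoord p i (h' y) = p i → K (s, y) = p i := by
    intro i
    by_cases hi : m ≤ i
    · obtain ⟨K⟩ := hP i hi (R i) (hRc i) ⟨_, hu i⟩ {y | extCoord p i (h' y) = p i} (fun y hy ↦ hy)
      exact ⟨K.toContinuousMap, fun y ↦ K.apply_zero y, fun y ↦ K.apply_one y,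
        fun s y hy ↦ (K.eq_fst s hy).trans hy⟩
    · have : IsEmpty (R i) := ⟨fun y ↦ hi y.2.1⟩
      exact ⟨⟨fun x ↦ p i, continuous_const⟩, fun y ↦ isEmptyElim y, fun y ↦ rfl, fun _ _ _ ↦ rfl⟩
  choose K hK0 hK1 hK2 using hK
  let H : ∀ i, C(R i × I, Telescope f) := fun i ↦
    (base f i).comp ((K i).comp ContinuousMap.prodSwap)
  have hH : ∀ i y s, H i (y, s) = base f i (K i (s, y)) := fun i y s ↦ rfl
  obtain ⟨G, hG0, hGR, hGn⟩ := exists_glue_homotopy h' ⟨fun y ↦ extHeight (h y),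
      continuous_extHeight.comp h.continuous⟩
    (fun y hy ↦ by rw [hh', extHeight_eq_top.1 hy]; rfl)
    (α := 2 / 3) (β := 4 / 3) (by norm_num) (by norm_num) m R (fun i ↦ rfl) H
    (fun i y ↦ by rw [hH, hK0, hbase])
    (fun i y s hy ↦ by
      obtain ⟨z, hz, hm, h1, h2⟩ := hRz i y
      simp only [ContinuousMap.coe_mk, hz, extHeight_coe] at hy
      rw [ENNReal.ofReal_eq_ofReal_iff (height_nonneg _) (by positivity),
        ENNReal.ofReal_eq_ofReal_iff (height_nonneg _) (by positivity)] at hy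
      have hr : OnRay p (h y) := by
        rcases hy with hy | hy
        · refine hray i y ?_
          rw [hz]
          exact coe_mem_strip hm (by linarith) (by linarith)
        · refine hray (i + 1) y ?_
          rw [hz]
          exact coe_mem_strip (by omega) (by push_cast; linarith) (by push_cast; linarith)
      obtain ⟨w, hw, hwi⟩ := hRz' i y
      have hr' := hray' y hr
      rw [hw, onRay_coe, hwi, ray_natCast] at hr'
      have h3 : extCoord p i (h' y) = p i := by
        rw [hw, ← hr']
        exact coord_base (f := f) p i (p i)
      rw [hH, hK2 i s y h3, hw, hr'])
    (fun i y s ↦ by rw [hH, height_base])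
  refine ⟨⟨fun y ↦ G (y, 1), by fun_prop⟩, hhom.trans ⟨⟨⟨⟨fun x ↦ G (x.2, x.1), by fun_prop⟩, hG0,
    fun y ↦ rfl⟩, fun s y hy ↦ hGn y s fun i hi ↦ ?_⟩⟩, fun y ↦ ?_⟩
  · obtain ⟨z, hz, -⟩ := hRz i ⟨y, hi⟩
    exact OnePoint.coe_ne_infty z (hz.symm.trans (hS y hy))
  · simp only [ContinuousMap.coe_mk]
    by_cases hx : ∃ j, y ∈ R j
    · obtain ⟨j, hj⟩ := hx
      left
      rw [hGR j ⟨y, hj⟩ 1, hH, hK1, onRay_coe, height_base, ray_natCast]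
    · rw [hGn y 1 (not_exists.1 hx)]
      obtain hy | ⟨z, hz⟩ : h y = OnePoint.infty ∨ ∃ z : Telescope f, h y = z := by
        generalize h y = x
        induction x using OnePoint.rec with
        | infty => exact Or.inl rfl
        | coe z => exact Or.inr ⟨z, rfl⟩
      · exact Or.inl (hray' y (hy ▸ onRay_infty))
      rcases le_or_gt (height z) (m + 2 / 3) with h1 | h1
      · right
        refine (hh' y ▸ extHeight_extFlow_le descent (h y) 1).trans ?_
        rw [hz]
        exact ENNReal.ofReal_le_ofReal (by linarith)
      · left
        refine hray' y (hray (⌊height z - 2 / 3⌋₊ + 1) y ?_)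
        have h0 : 0 ≤ height z - 2 / 3 := by linarith [m.cast_nonneg (α := ℝ)]
        have h2 := Nat.floor_le h0
        have h3 := Nat.lt_floor_add_one (height z - 2 / 3)
        have hm : m ≤ ⌊height z - 2 / 3⌋₊ := Nat.le_floor (by linarith)
        have h4 : ⌊height z - 2 / 3⌋₊ + 4 / 3 < height z := by
          by_contra! h4
          refine hx ⟨⌊height z - 2 / 3⌋₊, ?_⟩
          change h y ∈ strip m (2 / 3) (4 / 3) _
          rw [hz]
          exact coe_mem_strip hm (by linarith) h4
        rw [hz]
        exact coe_mem_strip (by omega) (by push_cast; linarith) (by push_cast; linarith)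

/-- The contraction of maps from `Y` to the compactified telescope, assuming that maps from closed
subsets of `Y` to the spaces `P i`, `i ≥ m`, contract to `p i` relative to the preimage of `p i`. -/
theorem homotopicRel_infty (hf : ∀ i, f i (p (i + 1)) = p i) (hP₀ : ∀ x : P 0, x = p 0)
    (hP : ∀ i, m ≤ i → ∀ (A : Set Y), IsClosed A → ∀ (u : C(A, P i)) (S : Set A),
      (∀ a ∈ S, u a = p i) → u.HomotopicRel (ContinuousMap.const A (p i)) S)
    (h : C(Y, OnePoint (Telescope f))) {S : Set Y} (hS : ∀ y ∈ S, h y = OnePoint.infty) :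
    h.HomotopicRel (ContinuousMap.const Y OnePoint.infty) S := by
  obtain ⟨g₁, hg₁, hray₁⟩ := exists_onRay_middle hf hP h hS
  have hS₁ : ∀ y ∈ S, g₁ y = OnePoint.infty := fun y hy ↦ (hg₁.fst_eq_snd hy).symm.trans (hS y hy)
  obtain ⟨g₂, hg₂, hray₂⟩ := exists_onRay_or_extHeight_le hf hP g₁ hS₁ hray₁
  have hS₂ : ∀ y ∈ S, g₂ y = OnePoint.infty := fun y hy ↦
    (hg₂.fst_eq_snd hy).symm.trans (hS₁ y hy)
  have hm : (0 : ℝ) ≤ m + 1 := by positivity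
  obtain ⟨g₃, hg₃', hg₃⟩ := homotopicRel_extFlow (d := fun _ ↦ (m : ℝ) + 1) continuous_const hm
    (fun _ ↦ le_rfl) g₂ hS₂
  have hS₃ : ∀ y ∈ S, g₃ y = OnePoint.infty := fun y hy ↦
    (hg₃.fst_eq_snd hy).symm.trans (hS₂ y hy)
  refine ((hg₁.trans hg₂).trans hg₃).trans
    (homotopicRel_infty_of_onRay hf g₃ (fun y ↦ ?_) hS₃)
  rw [hg₃']
  rcases hray₂ y with hy | hy
  · exact onRay_extFlow hf hy 1 fun _ ↦ hm
  · generalize g₂ y = x at hy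
    induction x using OnePoint.rec with
    | infty => exact onRay_infty
    | coe z =>
      rw [extHeight_coe, ENNReal.ofReal_le_ofReal_iff hm] at hy
      have h0 : height (flow z (height z - (m + 1))) = (0 : ℕ) := by
        rw [height_flow, max_eq_left (min_le_of_left_le (by linarith)), Nat.cast_zero]
      simp only [extFlow, OnePoint.elim_some, Set.Icc.coe_one, one_mul]
      rw [onRay_coe, ← base_coord p h0, height_base, ray_natCast, ← hP₀]

end Telescope

theorem mainTheorem3 (P : ℕ → Type*)
    [∀ i, TopologicalSpace (P i)] [∀ i, T2Space (P i)]
    [∀ i, CWComplex (Set.univ : Set (P i))]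
    [∀ i, CWComplex.Finite (Set.univ : Set (P i))]
    (f : ∀ i, C(P (i + 1), P i))
    (p : ∀ i, P i)
    (hP₀ : ∀ x : P 0, x = p 0)
    (hvertex : ∀ i, ∃ e : RelCWComplex.cell (Set.univ : Set (P i)) 0,
      (∀ e', e' = e) ∧ RelCWComplex.closedCell 0 e = {p i})
    (hf : ∀ i, f i (p (i + 1)) = p i)
    (hcell : ∀ i k : ℕ, 0 < k → k < i →
      IsEmpty (RelCWComplex.cell (Set.univ : Set (P i)) k))
    (n : ℕ) (hn : 1 ≤ n) :
    ∀ α : HawaiianGroup n (OnePoint (Telescope f)) OnePoint.infty, α = 1 := by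
  have : ∀ i, CompactSpace (P i) := fun i ↦ compactSpace_of_finite_CWComplex (P i)
  intro α
  obtain ⟨g, rfl⟩ := Quotient.exists_rep α
  refine Quotient.sound (Telescope.homotopicRel_infty (p := p) (m := n + 1) hf hP₀ ?_ g.1 ?_)
  · intro i hi A hA u S hS
    have : CompactSpace A := isCompact_iff_compactSpace.1 hA.isCompact
    refine homotopicRel_const_of_cells (hvertex i) (fun k hk hne ↦ ?_) u hS
    refine avoidsOrigin_hawaiianEarrings ?_ A hA
    by_contra! hkn
    exact not_isEmpty_iff.2 hne (hcell i k hk (by omega))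
  · rintro y rfl
    exact g.2
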